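/- Write $I=[0,3/2]$, let $\mathrm{Leb}$ be Lebesgue measure on $I$, and for a $C^1$ map $h:I\to I$ put $\|h'\|_\infty=\sup_{x\in I}|h'(x)|$ (one-sided derivatives at the endpoints). For $x\in I$ let $$\mu_n^x=\frac1n\sum_{0\le k<n}\delta_{h^k(x)},\qquad \chi(x)=\limsup_{n\to\infty}\frac1n\log|(h^n)'(x)|\in[-\infty,\infty),\qquad \Sigma\chi^+(x)=\max(0,\chi(x)),$$ let $pw(x)$ be the set of weak-$*$ accumulation points of $(\mu_n^x)_n$, and for an $h$-invariant Borel probability measure $\mu$ let $h(\mu)$ be its Kolmogorov–Sinai entropy and $\mathcal B_\mu=\{x:\mu_n^x\to\mu\}$ its basin; $\mu$ is called physical if $\mathrm{Leb}(\mathcal B_\mu)>0$. Theorem. For every integer $r\ge 1$ there is a map $h:[0,3/2]\to[0,3/2]$ of class $C^r$ but not of class $C^{r+1}$, with $h(0)=0$ and $|h'(0)|>1$, such that: (1) there is a measurable set $E\subset[0,3/2]$ with $\mathrm{Leb}(E)>0$ such that for every $x\in E$ the empirical measures $\mu_n^x$ converge weak-$*$ to the Dirac mass $\delta_0$, and $$\chi(x)=\frac{\log\|h'\|_\infty}{r}>0;$$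 (2) $\delta_0$ is a physical measure of $h$, and $h(\delta_0)=0$; (3) it is not true that for Lebesgue almost every $x\in I$ there is $\mu_x\in pw(x)$ with $h(\mu_x)\ge\Sigma\chi^+(x)$; (4) it is not true that every physical measure $\mu$ of $h$ satisfies $h(\mu)\ge\operatorname{ess\,sup}_{\mathcal B_\mu}\Sigma\chi^+$ (essential supremum with respect to $\mathrm{Leb}$). Parts (3) and (4) say that the inequalities "$h(\mu_x)\ge\Sigma\chi^+(x)$ for some $\mu_x\in pw(x)$, for almost every $x$" and "$h(\mu)\ge\operatorname{ess\,sup}_{\mathcal B_\mu}\Sigma\chi^+$ for every physical $\mu$", which are asserted for $C^\infty$ maps, fail in every finite smoothness class $C^r$. -/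

import Mathlib

open MeasureTheory Filter Topology

noncomputable section

namespace IntervalDynamics

section General

variable {X : Type*} [MeasurableSpace X]

/-- The empirical measure `(1/(n+1)) ∑_{0 ≤ k < n+1} δ_{T^k x}` of the first `n + 1` points of the
orbit of `x` (the index is shifted by one, so that every term is a probability measure). -/
def empiricalMeasure (T : X → X) (x : X) (n : ℕ) : ProbabilityMeasure X :=
  ⟨((n + 1 : ℕ) : ENNReal)⁻¹ • ∑ k ∈ Finset.range (n + 1), Measure.dirac (T^[k] x), ⟨by
    simp only [Measure.smul_apply, Measure.coe_finsetSum, Finset.sum_apply, measure_univ,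
      Finset.sum_const, Finset.card_range, nsmul_eq_mul, mul_one, smul_eq_mul]
    exact ENNReal.inv_mul_cancel (by simp) (ENNReal.natCast_ne_top _)⟩⟩

/-- The Dirac mass at `x`, as a probability measure. -/
def diracMass (x : X) : ProbabilityMeasure X := ⟨Measure.dirac x, inferInstance⟩

/-- The Shannon entropy, with respect to `μ`, of the join `⋁_{i < n} T^{-i} P` of a finite
measurable partition `P`, given by its labelling function `P : X → Fin k`. -/
def joinEntropy (T : X → X) (μ : Measure X) {k : ℕ} (P : X → Fin k) (n : ℕ) : ℝ :=
  ∑ a : Fin n → Fin k, Real.negMulLog (μ.real {x | ∀ i : Fin n, P (T^[i] x) = a i})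

/-- The Kolmogorov–Sinai entropy of `μ` (used for `T`-invariant `μ`): the supremum over all finite
measurable partitions `P` of the asymptotic rate of `H_μ(⋁_{i < n} T^{-i} P) / n`. -/
def metricEntropy (T : X → X) (μ : Measure X) : EReal :=
  ⨆ (k : ℕ) (P : X → Fin k) (_ : Measurable P),
    limsup (fun n : ℕ => ((joinEntropy T μ P n / n : ℝ) : EReal)) atTop

variable [TopologicalSpace X] [OpensMeasurableSpace X]

/-- `pw(x)`: the accumulation points, in the weak-* topology, of the empirical measures at `x`. -/
def accumulationMeasures (T : X → X) (x : X) : Set (ProbabilityMeasure X) :=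
  {μ | MapClusterPt μ atTop (empiricalMeasure T x)}

/-- The basin of `μ`: the points whose empirical measures converge to `μ`. -/
def basin (T : X → X) (μ : ProbabilityMeasure X) : Set X :=
  {x | Tendsto (empiricalMeasure T x) atTop (𝓝 μ)}

/-- `μ` is physical with respect to the reference measure `m`: it is invariant and its basin has
positive `m`-measure. -/
def IsPhysical (m : Measure X) (T : X → X) (μ : ProbabilityMeasure X) : Prop :=
  MeasurePreserving T (μ : Measure X) (μ : Measure X) ∧ 0 < m (basin T μ)

end General

/-- The compact interval `[0, 3/2]`. -/
abbrev I : Type := Set.Icc (0 : ℝ) (3 / 2)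

/-- Lebesgue measure on the interval. Its total mass `3/2` is not normalised, which changes
neither the null sets nor the sets of positive measure. -/
def leb : Measure I := (volume : Measure ℝ).comap Subtype.val

/-- The left endpoint `0` of the interval. -/
def origin : I := ⟨0, by norm_num, by norm_num⟩

/-- A self-map of the interval as a real function: it is extended to `ℝ` by constants, and only
its values on `[0, 3/2]` are ever used. -/
def toReal (T : I → I) : ℝ → ℝ :=
  Set.IccExtend (show (0 : ℝ) ≤ 3 / 2 by norm_num) fun x => (T x : ℝ)

/-- `T` is of class `C^r` on `[0, 3/2]`, up to the endpoints. -/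
def IsClassC (r : ℕ) (T : I → I) : Prop :=
  ContDiffOn ℝ r (toReal T) (Set.Icc (0 : ℝ) (3 / 2))

/-- The derivative of `T` at `x` (one-sided at the endpoints). -/
def derivAt (T : I → I) (x : I) : ℝ :=
  derivWithin (toReal T) (Set.Icc (0 : ℝ) (3 / 2)) x

/-- The supremum norm `‖T'‖_∞` of the derivative over `[0, 3/2]`. -/
def supDeriv (T : I → I) : ℝ := ⨆ x : I, |derivAt T x|

/-- The Lyapunov exponent `χ(x) = limsup (1/n) log |(T^n)'(x)|`, with `log 0 = -∞`. -/
def lyapunov (T : I → I) (x : I) : EReal :=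
  limsup (fun n : ℕ => ENNReal.log ‖derivAt T^[n] x‖ₑ / (n : EReal)) atTop

/-- `Σχ⁺(x)`, which is `max (0, χ(x))` in dimension one. -/
def sumPosLyapunov (T : I → I) (x : I) : EReal := max 0 (lyapunov T x)

end IntervalDynamics

end

namespace IntervalDynamics

/-! ### Powers of the positive part: the term that limits smoothness to `C^r`. -/

section PosPartPow

/-! Write Λ for `slope` and e_n for `expo n` = (n+1)^3. Near 0 the map is x ↦ Λx. Disjoint windows
of radius about 2^{-n} accumulate at 1/2. On the n-th one the map is Λ^{-r e_n} times an oscillation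
of frequency about Λ^{e_n} whose values fill the (n+1)-st window. One step throws the n-th window
next to 0, and r e_n linear steps carry the image exactly onto the (n+1)-st window. In normalised
coordinates the passage is u ↦ sin(ω_n u + t_n).

The amplitude Λ^{-r e_n} pays for r derivatives of the oscillation, each costing about Λ^{e_n}, so
the sum of all windows is `C^r` (`abs_iteratedDeriv_windowTerm_le`). A passage lasts 1 + r e_n steps
and expands by about Λ^{e_n}, which gives the exponent log Λ / r. Almost all of that time is spent
near 0, so empirical measures tend to the Dirac mass there, whose entropy is 0 (`sum_iterate_le`,
`metricEntropy_dirac`).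

The expansion fails only near zeros of the cosine. Choosing each phase t_n by pigeonhole keeps |cos|
≥ 2^{-(n+2)} off a proportion 2^{-(n+2)} of the initial window, so at least half of it survives
every passage (`exists_goodSet_pos`). The accumulated loss is at most 8^{n^2}, negligible against Λ
to a power at least n^3; this is why the exponents grow cubically. The upper bound |(h^k)'|^r ≤ Λ^k
holds at all times (`abs_deriv_iterate_pow_le`), so the limsup is exactly log Λ / r.

Finally, Λ exceeds the slope of every oscillation, hence is the sup norm of the derivative, and a
term max(0, x-1)^{r+1}, away from the windows, destroys `C^{r+1}` smoothness. -/

lemma hasDerivAt_max_zero_pow (k : ℕ) (x : ℝ) :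
    HasDerivAt (fun y : ℝ => max 0 y ^ (k + 2)) ((k + 2) * max 0 x ^ (k + 1)) x := by
  rcases lt_trichotomy x 0 with hx | rfl | hx
  · have h : (fun y : ℝ => max 0 y ^ (k + 2)) =ᶠ[𝓝 x] fun _ => 0 := by
      filter_upwards [gt_mem_nhds hx] with y hy
      simp [max_eq_left hy.le]
    simpa [max_eq_left hx.le] using (hasDerivAt_const x (0 : ℝ)).congr_of_eventuallyEq h
  · rw [hasDerivAt_iff_tendsto_slope]
    have hc : Continuous fun y : ℝ => max 0 y ^ (k + 1) := by fun_prop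
    have h0 : Tendsto (fun y : ℝ => max 0 y ^ (k + 1)) (𝓝[≠] 0) (𝓝 0) := by
      simpa using (hc.tendsto 0).mono_left nhdsWithin_le_nhds
    simp only [max_self, ne_eq, Nat.succ_ne_zero, not_false_eq_true, zero_pow, mul_zero]
    refine h0.congr' ?_
    filter_upwards [self_mem_nhdsWithin] with y hy
    have hy : y ≠ 0 := hy
    rw [slope_def_field]
    rcases le_total y 0 with h | h
    · simp [max_eq_left h]
    · simp [max_eq_right h]
      field_simp
      ring
  · have h : (fun y : ℝ => max 0 y ^ (k + 2)) =ᶠ[𝓝 x] fun y => y ^ (k + 2) := by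
      filter_upwards [lt_mem_nhds hx] with y hy
      simp [max_eq_right hy.le]
    have := (hasDerivAt_pow (k + 2) x).congr_of_eventuallyEq h
    simpa [max_eq_right hx.le] using this

lemma deriv_max_zero_pow (k : ℕ) :
    deriv (fun y : ℝ => max 0 y ^ (k + 2)) = fun x : ℝ => ((k : ℝ) + 2) * max 0 x ^ (k + 1) :=
  funext fun x => (hasDerivAt_max_zero_pow k x).deriv

lemma contDiff_max_zero_pow (k : ℕ) : ContDiff ℝ k fun y : ℝ => max 0 y ^ (k + 1) := by
  induction k with
  | zero =>
    simp only [zero_add, pow_one]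
    exact contDiff_zero.2 (by fun_prop)
  | succ k ih =>
    rw [Nat.cast_succ, contDiff_succ_iff_deriv]
    refine ⟨fun x => (hasDerivAt_max_zero_pow k x).differentiableAt, fun h => ?_, ?_⟩
    · simp at h
    · rw [deriv_max_zero_pow]
      exact contDiff_const.mul ih

/-- Differentiating lowers the exponent and the smoothness order together, down to the corner of |y|
= 2 max(0, y) - y. -/
lemma not_contDiffAt_max_zero_pow (k : ℕ) :
    ¬ ContDiffAt ℝ (k + 1 : ℕ) (fun y : ℝ => max 0 y ^ (k + 1)) 0 := by
  induction k with
  | zero =>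
    intro h
    have h1 : DifferentiableAt ℝ (fun y : ℝ => max 0 y) 0 := by
      simpa using h.differentiableAt (by simp)
    refine not_differentiableAt_abs_zero ?_
    have h2 : (abs : ℝ → ℝ) = fun y => 2 * max 0 y - y := by
      funext y
      rcases le_total y 0 with h | h
      · simp [max_eq_left h, abs_of_nonpos h]
      · simp [max_eq_right h, abs_of_nonneg h]; ring
    rw [h2]
    exact (h1.const_mul 2).sub differentiableAt_id
  | succ k ih =>
    intro h
    apply ih
    have h1 : ContDiffAt ℝ (k + 1 : ℕ) (deriv fun y : ℝ => max 0 y ^ (k + 2)) 0 := by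
      have := h.fderiv_right (m := (k + 1 : ℕ)) (by norm_cast)
      exact this.clm_apply contDiffAt_const
    rw [deriv_max_zero_pow] at h1
    have h2 := (contDiffAt_const (c := ((k : ℝ) + 2)⁻¹)).mul h1
    refine h2.congr_of_eventuallyEq (Eventually.of_forall fun y => ?_)
    have : (k : ℝ) + 2 ≠ 0 := by positivity
    simp only
    field_simp

end PosPartPow

/-! ### The smooth expanding branch at the fixed point. -/

section Expanding

/-- A bump function equal to `1` on `[-1, 1]` and supported in `[-3/2, 3/2]`. -/
noncomputable def slopeBump : ContDiffBump (0 : ℝ) := ⟨1, 3 / 2, by norm_num, by norm_num⟩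

/-- The slope of the expanding profile: `1` on `[0, 1]`, with vanishing integral over
`[0, 9/2]`. -/
noncomputable def profileSlope (s : ℝ) : ℝ := slopeBump s - slopeBump (s - 3) / 2

/-- A smooth function with `expandingProfile t = t` on `[0, 1]`, vanishing for `9/2 ≤ t`. -/
noncomputable def expandingProfile (t : ℝ) : ℝ := ∫ s in (0 : ℝ)..t, profileSlope s

lemma slopeBump_eq_one {s : ℝ} (h : |s| ≤ 1) : slopeBump s = 1 :=
  slopeBump.one_of_mem_closedBall (by simpa [slopeBump] using h)

lemma slopeBump_eq_zero {s : ℝ} (h : 3 / 2 ≤ |s|) : slopeBump s = 0 :=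
  slopeBump.zero_of_le_dist (by simpa [slopeBump] using h)

lemma contDiff_profileSlope {n : ℕ∞} : ContDiff ℝ n profileSlope :=
  slopeBump.contDiff.sub ((slopeBump.contDiff.comp (contDiff_id.sub contDiff_const)).div_const 2)

lemma continuous_profileSlope : Continuous profileSlope :=
  (contDiff_profileSlope (n := 0)).continuous

lemma hasDerivAt_expandingProfile (t : ℝ) :
    HasDerivAt expandingProfile (profileSlope t) t :=
  intervalIntegral.integral_hasDerivAt_right (continuous_profileSlope.intervalIntegrable _ _)
    (continuous_profileSlope.stronglyMeasurableAtFilter _ _) continuous_profileSlope.continuousAt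

lemma contDiff_expandingProfile (r : ℕ) : ContDiff ℝ r expandingProfile := by
  have h : ContDiff ℝ (r + 1 : ℕ) expandingProfile := by
    rw [Nat.cast_succ, contDiff_succ_iff_deriv]
    refine ⟨fun t => (hasDerivAt_expandingProfile t).differentiableAt, fun h => ?_, ?_⟩
    · simp at h
    · rw [show deriv expandingProfile = profileSlope from
        funext fun t => (hasDerivAt_expandingProfile t).deriv]
      exact contDiff_profileSlope (n := (r : ℕ∞))
  exact h.of_le (by norm_cast; omega)

lemma abs_profileSlope_le (s : ℝ) : |profileSlope s| ≤ 1 := by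
  have h1 := slopeBump.nonneg (x := s)
  have h2 := slopeBump.le_one (x := s)
  have h3 := slopeBump.nonneg (x := s - 3)
  have h4 := slopeBump.le_one (x := s - 3)
  rw [profileSlope, abs_le]
  constructor <;> linarith

lemma profileSlope_eq_one {s : ℝ} (h0 : 0 ≤ s) (h1 : s ≤ 1) : profileSlope s = 1 := by
  rw [profileSlope, slopeBump_eq_one (abs_le.2 ⟨by linarith, h1⟩), slopeBump_eq_zero]
  · norm_num
  · rw [abs_of_neg (by linarith)]; linarith

lemma expandingProfile_eq_self {t : ℝ} (h0 : 0 ≤ t) (h1 : t ≤ 1) : expandingProfile t = t := by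
  rw [expandingProfile, intervalIntegral.integral_congr (g := fun _ => 1)]
  · simp
  · intro s hs
    rw [Set.uIcc_of_le h0] at hs
    exact profileSlope_eq_one hs.1 (hs.2.trans h1)

lemma intervalIntegrable_slopeBump (a b : ℝ) : IntervalIntegrable slopeBump volume a b :=
  slopeBump.continuous.intervalIntegrable a b

/-- The profile rises under the right half of an even bump and falls under a full translated copy
with weight 1/2, so the two areas cancel. -/
lemma expandingProfile_nine_halves : expandingProfile (9 / 2) = 0 := by
  have hz : ∀ a b : ℝ, 3 / 2 ≤ a → a ≤ b → ∫ s in a..b, slopeBump s = 0 := by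
    intro a b ha hab
    rw [intervalIntegral.integral_congr (g := fun _ => 0)]
    · simp
    · intro s hs
      rw [Set.uIcc_of_le hab] at hs
      exact slopeBump_eq_zero (by rw [abs_of_nonneg] <;> linarith [hs.1])
  have hsymm : ∀ a b : ℝ, ∫ s in (-b)..(-a), slopeBump s = ∫ s in a..b, slopeBump s := by
    intro a b
    rw [← intervalIntegral.integral_comp_neg]
    simp [slopeBump.neg]
  have hc : Continuous fun s : ℝ => slopeBump (s - 3) :=
    slopeBump.continuous.comp (continuous_id.sub continuous_const)
  have e1 : expandingProfile (9 / 2) =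
      (∫ s in (0 : ℝ)..(9 / 2), slopeBump s) - (∫ s in (-3 : ℝ)..(3 / 2), slopeBump s) / 2 := by
    unfold expandingProfile profileSlope
    rw [intervalIntegral.integral_sub (intervalIntegrable_slopeBump _ _)
      ((hc.div_const 2).intervalIntegrable _ _), intervalIntegral.integral_div,
      intervalIntegral.integral_comp_sub_right (fun s => slopeBump s) 3]
    norm_num
  have e2 := intervalIntegral.integral_add_adjacent_intervals
    (intervalIntegrable_slopeBump 0 (3 / 2)) (intervalIntegrable_slopeBump (3 / 2) (9 / 2))
  have e3 := intervalIntegral.integral_add_adjacent_intervals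
    (intervalIntegrable_slopeBump (-3) (-(3 / 2))) (intervalIntegrable_slopeBump (-(3 / 2)) (3 / 2))
  have e4 := intervalIntegral.integral_add_adjacent_intervals
    (intervalIntegrable_slopeBump (-(3 / 2)) (-0)) (intervalIntegrable_slopeBump (-0) (3 / 2))
  have e5 := hsymm 0 (3 / 2)
  have e6 := hsymm (3 / 2) 3
  rw [hz _ _ le_rfl (by norm_num)] at e2 e6
  simp only [neg_zero] at e4 e5
  rw [e1]
  linarith

lemma expandingProfile_eq_zero {t : ℝ} (h : 9 / 2 ≤ t) : expandingProfile t = 0 := by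
  rw [← expandingProfile_nine_halves, ← sub_eq_zero, expandingProfile, expandingProfile,
    intervalIntegral.integral_interval_sub_left (continuous_profileSlope.intervalIntegrable _ _)
      (continuous_profileSlope.intervalIntegrable _ _),
    intervalIntegral.integral_congr (g := fun _ => 0)]
  · simp
  · intro s hs
    rw [Set.uIcc_of_le h] at hs
    simp only [profileSlope]
    rw [slopeBump_eq_zero, slopeBump_eq_zero]
    · norm_num
    · rw [abs_of_nonneg] <;> linarith [hs.1]
    · rw [abs_of_nonneg] <;> linarith [hs.1]

lemma antitoneOn_expandingProfile : AntitoneOn expandingProfile (Set.Ici (3 / 2)) := by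
  refine antitoneOn_of_deriv_nonpos (convex_Ici _)
    (contDiff_expandingProfile 0).continuous.continuousOn
    (fun t _ => (hasDerivAt_expandingProfile t).differentiableAt.differentiableWithinAt) ?_
  intro t ht
  rw [interior_Ici, Set.mem_Ioi] at ht
  rw [(hasDerivAt_expandingProfile t).deriv, profileSlope, slopeBump_eq_zero]
  · linarith [slopeBump.nonneg (x := t - 3)]
  · rw [abs_of_nonneg] <;> linarith

lemma monotoneOn_expandingProfile : MonotoneOn expandingProfile (Set.Iic (3 / 2)) := by
  refine monotoneOn_of_deriv_nonneg (convex_Iic _)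
    (contDiff_expandingProfile 0).continuous.continuousOn
    (fun t _ => (hasDerivAt_expandingProfile t).differentiableAt.differentiableWithinAt) ?_
  intro t ht
  rw [interior_Iic, Set.mem_Iio] at ht
  rw [(hasDerivAt_expandingProfile t).deriv, profileSlope, slopeBump_eq_zero (s := t - 3)]
  · linarith [slopeBump.nonneg (x := t)]
  · rw [abs_of_neg] <;> linarith

lemma expandingProfile_zero : expandingProfile 0 = 0 := by simp [expandingProfile]

/-- The maximum is at 3/2, where the slope changes sign, and the profile is 1-Lipschitz from the
value 0 at 0. -/
lemma expandingProfile_le (t : ℝ) : expandingProfile t ≤ 3 / 2 := by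
  have hm : expandingProfile t ≤ expandingProfile (3 / 2) := by
    rcases le_total t (3 / 2) with h | h
    · exact monotoneOn_expandingProfile h (Set.mem_Iic.2 le_rfl) h
    · exact antitoneOn_expandingProfile (Set.mem_Ici.2 le_rfl) h h
  refine hm.trans ?_
  have := intervalIntegral.norm_integral_le_of_norm_le_const (a := 0) (b := 3 / 2) (C := 1)
    (f := profileSlope) fun s _ => abs_profileSlope_le s
  rw [Real.norm_eq_abs] at this
  norm_num at this
  exact (le_abs_self _).trans this

lemma expandingProfile_nonneg {t : ℝ} (h0 : 0 ≤ t) : 0 ≤ expandingProfile t := by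
  rcases le_total t (3 / 2) with h | h
  · rw [← expandingProfile_zero]
    exact monotoneOn_expandingProfile (by norm_num : (0 : ℝ) ≤ 3 / 2) h h0
  · rcases le_total t (9 / 2) with h' | h'
    · rw [← expandingProfile_nine_halves]
      exact antitoneOn_expandingProfile h (by norm_num : (3 / 2 : ℝ) ≤ 9 / 2) h'
    · exact (expandingProfile_eq_zero h').ge

end Expanding

/-! ### Truncated oscillations with derivative bounds uniform in frequency and phase. -/

section Wiggle

/-- A bump function equal to `1` on `[-3/2, 3/2]` and supported in `[-2, 2]`. -/
noncomputable def cutoff : ContDiffBump (0 : ℝ) := ⟨3 / 2, 2, by norm_num, by norm_num⟩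

lemma cutoff_eq_one {s : ℝ} (h : |s| ≤ 3 / 2) : cutoff s = 1 :=
  cutoff.one_of_mem_closedBall (by simpa [cutoff] using h)

lemma cutoff_eq_zero {s : ℝ} (h : 2 ≤ |s|) : cutoff s = 0 :=
  cutoff.zero_of_le_dist (by simpa [cutoff] using h)

/-- A truncated oscillation of frequency `ω` and amplitude `a` around the level `c`. -/
noncomputable def wiggle (c a ω t : ℝ) (u : ℝ) : ℝ := cutoff u * (c + a * Real.sin (ω * u + t))

lemma contDiff_wiggle (c a ω t : ℝ) {n : ℕ∞} : ContDiff ℝ n (wiggle c a ω t) := by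
  have h : ContDiff ℝ n fun u : ℝ => c + a * Real.sin (ω * u + t) := by fun_prop
  exact cutoff.contDiff.mul h

lemma abs_iteratedDeriv_oscillation_le {c a ω : ℝ} (t : ℝ) (hc : |c| ≤ 1) (ha : |a| ≤ 1)
    (hω : 1 ≤ ω) (k : ℕ) (u : ℝ) :
    |iteratedDeriv k (fun u => c + a * Real.sin (ω * u + t)) u| ≤ 2 * ω ^ k := by
  rcases k.eq_zero_or_pos with rfl | hk
  · simp only [iteratedDeriv_zero, pow_zero, mul_one]
    have := abs_mul a (Real.sin (ω * u + t))
    have h1 : |a| * |Real.sin (ω * u + t)| ≤ 1 * 1 :=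
      mul_le_mul ha (Real.abs_sin_le_one _) (abs_nonneg _) zero_le_one
    linarith [abs_add_le c (a * Real.sin (ω * u + t))]
  · have h1 : iteratedDeriv k (fun u => c + a * Real.sin (ω * u + t)) =
        iteratedDeriv k (fun u => a * Real.sin (ω * u + t)) := by
      funext v
      exact iteratedDeriv_const_add hk c
    have h2 : iteratedDeriv k (fun u => Real.sin (ω * u + t)) u =
        ω ^ k * iteratedDeriv k Real.sin (ω * u + t) := by
      have := congrFun (iteratedDeriv_comp_const_mul (n := k)
        (f := fun v => Real.sin (v + t)) (by fun_prop) ω) u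
      simp only [iteratedDeriv_comp_add_const] at this
      exact this
    rw [h1, iteratedDeriv_const_mul_field, h2, abs_mul, abs_mul,
      abs_of_nonneg (show (0 : ℝ) ≤ ω ^ k by positivity)]
    have h3 := Real.abs_iteratedDeriv_sin_le_one k (ω * u + t)
    have h4 : (0 : ℝ) ≤ ω ^ k := by positivity
    calc |a| * (ω ^ k * |iteratedDeriv k Real.sin (ω * u + t)|) ≤ 1 * (ω ^ k * 1) := by gcongr
      _ ≤ 2 * ω ^ k := by linarith

/-- Leibniz' rule, with ω^{k-i} ≤ ω^k since ω ≥ 1. Uniformity in all parameters allows the slope of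
the map to be fixed before the frequencies, which depend on it, and before the phases. -/
lemma exists_abs_iteratedDeriv_wiggle_le :
    ∃ C : ℕ → ℝ, (∀ k, 0 ≤ C k) ∧ ∀ (k : ℕ) (c a ω t : ℝ), |c| ≤ 1 → |a| ≤ 1 → 1 ≤ ω →
      ∀ u, |iteratedDeriv k (wiggle c a ω t) u| ≤ C k * ω ^ k := by
  have hB : ∀ k : ℕ, ∃ D : ℝ, ∀ u, ‖iteratedFDeriv ℝ k cutoff u‖ ≤ D := fun k =>
    (cutoff.hasCompactSupport.iteratedFDeriv k).exists_bound_of_continuous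
      ((cutoff.contDiff (n := (k : ℕ∞))).continuous_iteratedFDeriv (by norm_cast))
  choose D hD using hB
  have hD0 : ∀ k, 0 ≤ D k := fun k => (norm_nonneg _).trans (hD k 0)
  refine ⟨fun k => ∑ i ∈ Finset.range (k + 1), k.choose i * D i * 2, fun k =>
    Finset.sum_nonneg fun i _ => by have := hD0 i; positivity, ?_⟩
  intro k c a ω t hc ha hω u
  have hf : ContDiff ℝ k fun u : ℝ => c + a * Real.sin (ω * u + t) := by fun_prop
  rw [← Real.norm_eq_abs, ← norm_iteratedFDeriv_eq_norm_iteratedDeriv]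
  refine (norm_iteratedFDeriv_mul_le (N := k) (cutoff.contDiff (n := (k : ℕ∞))) hf u
    (n := k) le_rfl).trans ?_
  rw [Finset.sum_mul]
  refine Finset.sum_le_sum fun i hi => ?_
  have hik : k - i ≤ k := Nat.sub_le _ _
  have h1 : ‖iteratedFDeriv ℝ (k - i) (fun u => c + a * Real.sin (ω * u + t)) u‖ ≤ 2 * ω ^ k := by
    rw [norm_iteratedFDeriv_eq_norm_iteratedDeriv, Real.norm_eq_abs]
    refine (abs_iteratedDeriv_oscillation_le t hc ha hω _ u).trans ?_
    gcongr
  calc _ ≤ (k.choose i : ℝ) * D i * (2 * ω ^ k) := by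
        have := hD0 i
        gcongr
        exact hD i u
    _ = _ := by ring

end Wiggle

/-! ### The map: oscillation windows, `C^r` regularity, and derivatives. -/

section Construction

/-- Constants bounding the derivatives of `wiggle`, uniformly in the frequency. -/
noncomputable def wiggleBound : ℕ → ℝ := exists_abs_iteratedDeriv_wiggle_le.choose

lemma wiggleBound_nonneg (k : ℕ) : 0 ≤ wiggleBound k :=
  exists_abs_iteratedDeriv_wiggle_le.choose_spec.1 k

lemma abs_iteratedDeriv_wiggle_le (k : ℕ) {c a ω : ℝ} (t : ℝ) (hc : |c| ≤ 1) (ha : |a| ≤ 1)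
    (hω : 1 ≤ ω) (u : ℝ) : |iteratedDeriv k (wiggle c a ω t) u| ≤ wiggleBound k * ω ^ k :=
  exists_abs_iteratedDeriv_wiggle_le.choose_spec.2 k c a ω t hc ha hω u

/-- The slope of the map at the fixed point `0`, which is also its maximal slope. -/
noncomputable def slope : ℝ := 16 + 64 * wiggleBound 1

lemma sixteen_le_slope : 16 ≤ slope := by
  have := wiggleBound_nonneg 1
  unfold slope; linarith

lemma slope_pos : 0 < slope := by linarith [sixteen_le_slope]

lemma one_le_slope : 1 ≤ slope := by linarith [sixteen_le_slope]

/-- The centre of the `n`-th oscillation window. -/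
noncomputable def center (n : ℕ) : ℝ := 1 / 2 + 1 / 4 * (1 / 2) ^ n

/-- The radius of the `n`-th oscillation window. -/
noncomputable def radius (n : ℕ) : ℝ := 1 / 32 * (1 / 2) ^ n

/-- The exponential growth exponent of the frequency in the `n`-th window. -/
def expo (n : ℕ) : ℕ := (n + 1) ^ 3

/-- The frequency of the oscillation in the `n`-th window. -/
noncomputable def freq (n : ℕ) : ℝ := slope ^ expo n / 4 ^ n

lemma succ_le_expo (n : ℕ) : n + 1 ≤ expo n := Nat.le_self_pow (by norm_num) _

lemma half_pow_pos (n : ℕ) : (0 : ℝ) < (1 / 2) ^ n := by positivity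

lemma half_pow_le_one (n : ℕ) : ((1 : ℝ) / 2) ^ n ≤ 1 := pow_le_one₀ (by norm_num) (by norm_num)

lemma radius_pos (n : ℕ) : 0 < radius n := by unfold radius; positivity

lemma radius_le (n : ℕ) : radius n ≤ 1 / 32 := by
  unfold radius; linarith [half_pow_le_one n]

lemma half_lt_center_sub (n : ℕ) : 1 / 2 < center n - 2 * radius n := by
  unfold center radius; linarith [half_pow_pos n]

lemma center_add_lt (n : ℕ) : center n + 2 * radius n ≤ 7 / 8 := by
  unfold center radius; linarith [half_pow_le_one n]

lemma radius_succ (n : ℕ) : radius (n + 1) = radius n / 2 := by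
  unfold radius; rw [pow_succ]; ring

lemma four_pow_le (n : ℕ) : (4 : ℝ) ^ n ≤ slope ^ expo n :=
  (pow_le_pow_left₀ (by norm_num) (by linarith [sixteen_le_slope]) n).trans
    (pow_le_pow_right₀ one_le_slope ((Nat.le_succ n).trans (succ_le_expo n)))

lemma one_le_freq (n : ℕ) : 1 ≤ freq n := by
  unfold freq
  rw [one_le_div (by positivity)]
  exact four_pow_le n

/-- The oscillation in the `n`-th window. -/
noncomputable def windowTerm (r : ℕ) (t : ℕ → ℝ) (n : ℕ) (x : ℝ) : ℝ :=
  (slope ^ (r * expo n))⁻¹ * wiggle (center (n + 1)) (radius (n + 1)) (freq n) (t n)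
    ((radius n)⁻¹ * (x - center n))

variable {r : ℕ} {t : ℕ → ℝ}

lemma contDiff_windowTerm (n : ℕ) {N : ℕ∞} : ContDiff ℝ N (windowTerm r t n) :=
  contDiff_const.mul ((contDiff_wiggle _ _ _ _).comp
    (contDiff_const.mul (contDiff_id.sub contDiff_const)))

lemma iteratedDeriv_windowTerm (k n : ℕ) (x : ℝ) :
    iteratedDeriv k (windowTerm r t n) x = (slope ^ (r * expo n))⁻¹ * ((radius n)⁻¹ ^ k *
      iteratedDeriv k (wiggle (center (n + 1)) (radius (n + 1)) (freq n) (t n))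
        ((radius n)⁻¹ * (x - center n))) := by
  unfold windowTerm
  rw [iteratedDeriv_const_mul_field]
  congr 1
  have h := iteratedDeriv_comp_const_mul (n := k) (contDiff_wiggle (n := (k : ℕ∞))
    (center (n + 1)) (radius (n + 1)) (freq n) (t n)) (radius n)⁻¹
  have h2 := congrFun (iteratedDeriv_comp_sub_const k (fun y =>
    wiggle (center (n + 1)) (radius (n + 1)) (freq n) (t n) ((radius n)⁻¹ * y)) (center n)) x
  rw [h2, h]

lemma abs_center_le (n : ℕ) : |center n| ≤ 1 := by
  rw [abs_le]
  constructor <;> linarith [half_lt_center_sub n, center_add_lt n, radius_pos n]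

lemma abs_radius_le (n : ℕ) : |radius n| ≤ 1 := by
  rw [abs_of_pos (radius_pos n)]
  linarith [radius_le n]

lemma inv_slope_pow_le (hr : 1 ≤ r) (n : ℕ) :
    (slope ^ (r * expo n))⁻¹ ≤ (1 / 4) ^ (n + 1) := by
  rw [one_div, inv_pow]
  gcongr
  calc (4 : ℝ) ^ (n + 1) ≤ slope ^ (n + 1) := by
        gcongr
        linarith [sixteen_le_slope]
    _ ≤ slope ^ (r * expo n) := pow_le_pow_right₀ one_le_slope
        ((succ_le_expo n).trans (Nat.le_mul_of_pos_left _ hr))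

lemma inv_radius_mul_freq (n : ℕ) :
    (radius n)⁻¹ * freq n = 32 * slope ^ expo n * (1 / 2) ^ n := by
  unfold radius freq
  rw [show (4 : ℝ) ^ n = 2 ^ n * 2 ^ n by rw [← mul_pow]; norm_num, one_div_pow]
  field_simp

/-- Each derivative costs frequency over radius, that is 32 Λ^{e_n} 2^{-n}. For k ≤ r the amplitude
Λ^{-r e_n} absorbs the powers of Λ. The factor 4^{-n} in `freq` outweighs the 2^n from the radius
and leaves a summable remainder even at k = r. -/
lemma abs_iteratedDeriv_windowTerm_le (hr : 1 ≤ r) {k : ℕ} (hk : k ≤ r) (n : ℕ) (x : ℝ) :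
    |iteratedDeriv k (windowTerm r t n) x| ≤ wiggleBound k * 32 ^ k * (1 / 2) ^ n := by
  have hS := slope_pos
  have hR := radius_pos n
  have hw := wiggleBound_nonneg k
  rw [iteratedDeriv_windowTerm, abs_mul, abs_mul, abs_of_pos (inv_pos.2 (pow_pos hS _)),
    abs_of_pos (pow_pos (inv_pos.2 hR) _)]
  have h1 := abs_iteratedDeriv_wiggle_le k (t n) (abs_center_le (n + 1)) (abs_radius_le (n + 1))
    (one_le_freq n) ((radius n)⁻¹ * (x - center n))
  have h2 : (slope ^ (r * expo n))⁻¹ * (slope ^ expo n * (1 / 2) ^ n) ^ k ≤ (1 / 2) ^ n := by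
    -- Without a derivative there is no factor 2^{-n} from the frequency; the decay then comes from
    -- the amplitude itself.
    rcases k.eq_zero_or_pos with rfl | hk0
    · simp only [pow_zero, mul_one]
      refine (inv_slope_pow_le hr n).trans ?_
      calc ((1 : ℝ) / 4) ^ (n + 1) ≤ (1 / 2) ^ (n + 1) := by gcongr; norm_num
        _ ≤ (1 / 2) ^ n := pow_le_pow_of_le_one (by norm_num) (by norm_num) (Nat.le_succ n)
    · have h3 : (slope ^ expo n) ^ k ≤ slope ^ (r * expo n) := by
        rw [← pow_mul, mul_comm]
        exact pow_le_pow_right₀ one_le_slope (Nat.mul_le_mul_right _ hk)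
      have h4 : (((1 : ℝ) / 2) ^ n) ^ k ≤ (1 / 2) ^ n :=
        pow_le_of_le_one (by positivity) (half_pow_le_one n) hk0.ne'
      rw [mul_pow]
      calc _ ≤ (slope ^ (r * expo n))⁻¹ * (slope ^ (r * expo n) * (1 / 2) ^ n) := by gcongr
        _ = _ := by field_simp
  calc _ ≤ (slope ^ (r * expo n))⁻¹ * ((radius n)⁻¹ ^ k * (wiggleBound k * freq n ^ k)) := by
        gcongr
    _ = wiggleBound k * 32 ^ k *
        ((slope ^ (r * expo n))⁻¹ * (slope ^ expo n * (1 / 2) ^ n) ^ k) := by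
        rw [show (slope ^ (r * expo n))⁻¹ * ((radius n)⁻¹ ^ k * (wiggleBound k * freq n ^ k)) =
          wiggleBound k * ((slope ^ (r * expo n))⁻¹ * ((radius n)⁻¹ * freq n) ^ k) by
            rw [mul_pow]; ring, inv_radius_mul_freq, mul_assoc 32, mul_pow 32]
        ring
    _ ≤ _ := by gcongr

lemma summable_half_pow_mul (C : ℝ) : Summable fun n : ℕ => C * (1 / 2 : ℝ) ^ n :=
  (summable_geometric_of_lt_one (by norm_num) (by norm_num)).mul_left C

lemma windowTerm_eq_zero {n : ℕ} {x : ℝ} (h : 2 * radius n ≤ |x - center n|) :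
    windowTerm r t n x = 0 := by
  have : cutoff ((radius n)⁻¹ * (x - center n)) = 0 := by
    apply cutoff_eq_zero
    rw [abs_mul, abs_of_pos (inv_pos.2 (radius_pos n)), inv_mul_eq_div, le_div_iff₀ (radius_pos n)]
    exact h
  simp [windowTerm, wiggle, this]

lemma windowTerm_eq {n : ℕ} {x : ℝ} (h : |x - center n| ≤ 3 / 2 * radius n) :
    windowTerm r t n x = (slope ^ (r * expo n))⁻¹ * (center (n + 1) + radius (n + 1) *
      Real.sin (freq n * ((radius n)⁻¹ * (x - center n)) + t n)) := by
  have : cutoff ((radius n)⁻¹ * (x - center n)) = 1 := by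
    apply cutoff_eq_one
    rw [abs_mul, abs_of_pos (inv_pos.2 (radius_pos n)), inv_mul_eq_div, div_le_iff₀ (radius_pos n)]
    exact h
  simp [windowTerm, wiggle, this]

/-- Consecutive centers are 4 `radius n` apart, more than the 3/2 + 1 radii needed here, so at most
one oscillation is active near each window. -/
lemma two_radius_le_of_ne {n k : ℕ} (hk : k ≠ n) {x : ℝ} (h : |x - center n| ≤ 3 / 2 * radius n) :
    2 * radius k ≤ |x - center k| := by
  have key : ∀ {i j : ℕ}, i < j → ((1 : ℝ) / 2) ^ j ≤ (1 / 2) ^ i / 2 := by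
    intro i j hij
    calc ((1 : ℝ) / 2) ^ j ≤ (1 / 2) ^ (i + 1) :=
          pow_le_pow_of_le_one (by norm_num) (by norm_num) hij
      _ = _ := by rw [pow_succ]; ring
  have hn := half_pow_pos n
  have hk' := half_pow_pos k
  rw [abs_le] at h
  rw [le_abs]
  unfold center radius at *
  rcases lt_or_gt_of_ne hk with hlt | hlt
  · right; linarith [key hlt, h.1, h.2]
  · left; linarith [key hlt, h.1, h.2]

/-- The sum of all oscillations. -/
noncomputable def windowSum (r : ℕ) (t : ℕ → ℝ) (x : ℝ) : ℝ := ∑' n, windowTerm r t n x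

lemma contDiff_windowSum (hr : 1 ≤ r) : ContDiff ℝ r (windowSum r t) := by
  refine contDiff_tsum (N := (r : ℕ∞))
    (v := fun k n => wiggleBound k * 32 ^ k * (1 / 2) ^ n)
    (fun n => contDiff_windowTerm n) (fun k _ => summable_half_pow_mul _) ?_
  intro k n x hk
  rw [norm_iteratedFDeriv_eq_norm_iteratedDeriv, Real.norm_eq_abs]
  exact abs_iteratedDeriv_windowTerm_le hr (by exact_mod_cast hk) n x

lemma windowSum_eq {n : ℕ} {x : ℝ} (h : |x - center n| ≤ 3 / 2 * radius n) :
    windowSum r t x = (slope ^ (r * expo n))⁻¹ * (center (n + 1) + radius (n + 1) *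
      Real.sin (freq n * ((radius n)⁻¹ * (x - center n)) + t n)) := by
  rw [windowSum, tsum_eq_single n, windowTerm_eq h]
  intro k hk
  exact windowTerm_eq_zero (two_radius_le_of_ne hk h)

lemma windowSum_eq_zero_of_le {x : ℝ} (h : x ≤ 1 / 2) : windowSum r t x = 0 := by
  rw [windowSum, tsum_congr (g := fun _ => 0), tsum_zero]
  intro n
  apply windowTerm_eq_zero
  rw [le_abs]
  right
  linarith [half_lt_center_sub n]

lemma windowSum_eq_zero_of_ge {x : ℝ} (h : 7 / 8 ≤ x) : windowSum r t x = 0 := by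
  rw [windowSum, tsum_congr (g := fun _ => 0), tsum_zero]
  intro n
  apply windowTerm_eq_zero
  rw [le_abs]
  left
  linarith [center_add_lt n]

lemma windowTerm_mem (hr : 1 ≤ r) (n : ℕ) (x : ℝ) :
    0 ≤ windowTerm r t n x ∧ windowTerm r t n x ≤ 1 / 4 * (1 / 2) ^ n := by
  have h1 := Real.neg_one_le_sin (freq n * ((radius n)⁻¹ * (x - center n)) + t n)
  have h2 := Real.sin_le_one (freq n * ((radius n)⁻¹ * (x - center n)) + t n)
  have h3 := radius_pos (n + 1)
  have h4 := half_lt_center_sub (n + 1)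
  have h5 := center_add_lt (n + 1)
  have h6 := cutoff.nonneg (x := (radius n)⁻¹ * (x - center n))
  have h7 := cutoff.le_one (x := (radius n)⁻¹ * (x - center n))
  have h8 := inv_slope_pow_le hr n
  have h9 : 0 ≤ (slope ^ (r * expo n))⁻¹ := (inv_pos.2 (pow_pos slope_pos _)).le
  have h10 : ((1 : ℝ) / 4) ^ (n + 1) ≤ 1 / 4 * (1 / 2) ^ n := by
    rw [pow_succ, mul_comm]
    gcongr
    norm_num
  unfold windowTerm wiggle
  set s := Real.sin (freq n * ((radius n)⁻¹ * (x - center n)) + t n)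
  have h11 : 0 ≤ center (n + 1) + radius (n + 1) * s := by nlinarith
  have h12 : center (n + 1) + radius (n + 1) * s ≤ 1 := by nlinarith
  refine ⟨by positivity, ?_⟩
  calc _ ≤ (slope ^ (r * expo n))⁻¹ * (1 * 1) := by gcongr
    _ ≤ _ := by linarith

lemma tsum_half_pow : ∑' n : ℕ, (1 / 2 : ℝ) ^ n = 2 := tsum_geometric_two

lemma windowSum_nonneg (hr : 1 ≤ r) (x : ℝ) : 0 ≤ windowSum r t x :=
  tsum_nonneg fun n => (windowTerm_mem hr n x).1

lemma windowSum_le (hr : 1 ≤ r) (x : ℝ) : windowSum r t x ≤ 1 / 2 := by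
  have hs : Summable fun n => windowTerm r t n x :=
    Summable.of_nonneg_of_le (fun n => (windowTerm_mem hr n x).1)
      (fun n => (windowTerm_mem hr n x).2) (summable_half_pow_mul _)
  calc windowSum r t x ≤ ∑' n : ℕ, 1 / 4 * (1 / 2 : ℝ) ^ n :=
        hs.tsum_le_tsum (fun n => (windowTerm_mem hr n x).2) (summable_half_pow_mul _)
    _ = 1 / 2 := by rw [tsum_mul_left, tsum_half_pow]; norm_num

/-- Summing the first-derivative bounds gives 32 · 2 · `wiggleBound 1`; this is the origin of the 64
in `slope`. -/
lemma abs_deriv_windowSum_le (hr : 1 ≤ r) (x : ℝ) : |deriv (windowSum r t) x| ≤ slope - 1 := by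
  have hb : ∀ n y, ‖deriv (windowTerm r t n) y‖ ≤ wiggleBound 1 * 32 * (1 / 2) ^ n := by
    intro n y
    have := abs_iteratedDeriv_windowTerm_le (t := t) hr hr n y
    rwa [iteratedDeriv_one, pow_one] at this
  have hd : deriv (windowSum r t) x = ∑' n, deriv (windowTerm r t n) x := by
    refine deriv_tsum_apply (y₀ := (0 : ℝ)) (summable_half_pow_mul _) (fun n y => ?_) hb ?_ x
    · exact (contDiff_windowTerm n (N := 1)).differentiable (by simp) y
    · exact Summable.of_nonneg_of_le (fun n => (windowTerm_mem hr n _).1)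
        (fun n => (windowTerm_mem hr n _).2) (summable_half_pow_mul _)
  rw [hd, ← Real.norm_eq_abs]
  refine (tsum_of_norm_bounded (summable_half_pow_mul _).hasSum fun n => hb n x).trans ?_
  rw [tsum_mul_left, tsum_half_pow, slope]
  linarith

/-- The map, as a function on the real line. -/
noncomputable def wigglyMap (r : ℕ) (t : ℕ → ℝ) (x : ℝ) : ℝ :=
  expandingProfile (slope * x) + windowSum r t x + max 0 (x - 1) ^ (r + 1)

lemma contDiff_wigglyMap (hr : 1 ≤ r) : ContDiff ℝ r (wigglyMap r t) := by
  refine (((contDiff_expandingProfile r).comp (contDiff_const.mul contDiff_id)).add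
    (contDiff_windowSum hr)).add ?_
  exact (contDiff_max_zero_pow r).comp (contDiff_id.sub contDiff_const)

lemma differentiable_wigglyMap (hr : 1 ≤ r) : Differentiable ℝ (wigglyMap r t) :=
  (contDiff_wigglyMap hr).differentiable (by simp; omega)

lemma expandingProfile_slope_mul_eq_zero {x : ℝ} (h : 3 / 8 ≤ x) :
    expandingProfile (slope * x) = 0 := by
  apply expandingProfile_eq_zero
  nlinarith [sixteen_le_slope]

lemma wigglyMap_eq_of_le {x : ℝ} (h : x ≤ 1 / 2) :
    wigglyMap r t x = expandingProfile (slope * x) := by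
  simp [wigglyMap, windowSum_eq_zero_of_le h, max_eq_left (show x - 1 ≤ 0 by linarith)]

lemma wigglyMap_eq_of_mem {x : ℝ} (h : 3 / 8 ≤ x) (h1 : x ≤ 1) :
    wigglyMap r t x = windowSum r t x := by
  simp [wigglyMap, expandingProfile_slope_mul_eq_zero h, max_eq_left (show x - 1 ≤ 0 by linarith)]

lemma wigglyMap_eq_of_ge {x : ℝ} (h : 7 / 8 ≤ x) :
    wigglyMap r t x = max 0 (x - 1) ^ (r + 1) := by
  simp [wigglyMap, expandingProfile_slope_mul_eq_zero (show 3 / 8 ≤ x by linarith),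
    windowSum_eq_zero_of_ge h]

lemma wigglyMap_mem (hr : 1 ≤ r) {x : ℝ} (hx : x ∈ Set.Icc (0 : ℝ) (3 / 2)) :
    wigglyMap r t x ∈ Set.Icc (0 : ℝ) (3 / 2) := by
  obtain ⟨h0, h1⟩ := hx
  rcases le_total x (1 / 2) with h | h
  · rw [wigglyMap_eq_of_le h]
    exact ⟨expandingProfile_nonneg (mul_nonneg slope_pos.le h0), expandingProfile_le _⟩
  · rcases le_total x 1 with h' | h'
    · rw [wigglyMap_eq_of_mem (by linarith) h']
      exact ⟨windowSum_nonneg hr x, (windowSum_le hr x).trans (by norm_num)⟩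
    · rw [wigglyMap_eq_of_ge (by linarith), max_eq_right (by linarith)]
      refine ⟨pow_nonneg (by linarith) _, ?_⟩
      exact (pow_le_one₀ (by linarith) (by linarith)).trans (by norm_num)

lemma hasDerivAt_expandingProfile_slope_mul (x : ℝ) :
    HasDerivAt (fun y => expandingProfile (slope * y)) (slope * profileSlope (slope * x)) x := by
  have := (hasDerivAt_expandingProfile (slope * x)).comp x ((hasDerivAt_id x).const_mul slope)
  simpa [Function.comp_def, mul_comm] using this

lemma deriv_wigglyMap_of_lt {x : ℝ} (h : x < 1 / 2) :
    deriv (wigglyMap r t) x = slope * profileSlope (slope * x) := by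
  have : wigglyMap r t =ᶠ[𝓝 x] fun y => expandingProfile (slope * y) := by
    filter_upwards [gt_mem_nhds h] with y hy using wigglyMap_eq_of_le hy.le
  rw [this.deriv_eq, (hasDerivAt_expandingProfile_slope_mul x).deriv]

lemma deriv_wigglyMap_of_mem {x : ℝ} (h : 3 / 8 < x) (h1 : x < 1) :
    deriv (wigglyMap r t) x = deriv (windowSum r t) x := by
  apply EventuallyEq.deriv_eq
  filter_upwards [lt_mem_nhds h, gt_mem_nhds h1] with y hy hy1
  exact wigglyMap_eq_of_mem hy.le hy1.le

lemma deriv_wigglyMap_of_gt (hr : 1 ≤ r) {x : ℝ} (h : 7 / 8 < x) :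
    deriv (wigglyMap r t) x = (r + 1) * max 0 (x - 1) ^ r := by
  have : wigglyMap r t =ᶠ[𝓝 x] fun y => max 0 (y - 1) ^ (r + 1) := by
    filter_upwards [lt_mem_nhds h] with y hy using wigglyMap_eq_of_ge hy.le
  obtain ⟨k, rfl⟩ : ∃ k, r = k + 1 := ⟨r - 1, by omega⟩
  have h2 := (hasDerivAt_max_zero_pow k (x - 1)).comp x ((hasDerivAt_id x).sub_const 1)
  rw [this.deriv_eq]
  have := h2.deriv
  simp only [Function.comp_def, id] at this
  rw [this]
  push_cast
  ring

/-- The expanding branch, the windows and the final power live on separate ranges of x, so their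
slopes are bounded one at a time. The last uses (r+1) 2^{-r} ≤ 1. -/
lemma abs_deriv_wigglyMap_le (hr : 1 ≤ r) {x : ℝ} (hx : x ≤ 3 / 2) :
    |deriv (wigglyMap r t) x| ≤ slope := by
  have hS := sixteen_le_slope
  rcases lt_or_ge x (1 / 2) with h | h
  · rw [deriv_wigglyMap_of_lt h, abs_mul, abs_of_pos slope_pos]
    exact mul_le_of_le_one_right slope_pos.le (abs_profileSlope_le _)
  · rcases lt_or_ge x 1 with h' | h'
    · rw [deriv_wigglyMap_of_mem (by linarith) h']
      linarith [abs_deriv_windowSum_le (t := t) hr x]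
    · rw [deriv_wigglyMap_of_gt hr (by linarith), max_eq_right (by linarith),
        abs_of_nonneg (mul_nonneg (by positivity) (pow_nonneg (by linarith) _))]
      have h1 : (x - 1) ^ r ≤ (1 / 2) ^ r := pow_le_pow_left₀ (by linarith) (by linarith) r
      have h2 : ((r : ℝ) + 1) ≤ 2 ^ r := by exact_mod_cast Nat.lt_two_pow_self (n := r)
      calc ((r : ℝ) + 1) * (x - 1) ^ r ≤ 2 ^ r * (1 / 2) ^ r := by gcongr
        _ = 1 := by rw [← mul_pow]; norm_num
        _ ≤ slope := one_le_slope

lemma wigglyMap_linear {x : ℝ} (h0 : 0 ≤ x) (h1 : slope * x ≤ 1) :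
    wigglyMap r t x = slope * x := by
  rw [wigglyMap_eq_of_le (by nlinarith [sixteen_le_slope]),
    expandingProfile_eq_self (mul_nonneg slope_pos.le h0) h1]

lemma deriv_wigglyMap_linear {x : ℝ} (h0 : 0 ≤ x) (h1 : slope * x ≤ 1) :
    deriv (wigglyMap r t) x = slope := by
  rw [deriv_wigglyMap_of_lt (by nlinarith [sixteen_le_slope]),
    profileSlope_eq_one (mul_nonneg slope_pos.le h0) h1, mul_one]

lemma window_mem {n : ℕ} {u : ℝ} (hu : |u| ≤ 1) :
    1 / 2 < center n + radius n * u ∧ center n + radius n * u < 1 := by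
  have h1 := half_lt_center_sub n
  have h2 := center_add_lt n
  have h3 := radius_pos n
  rw [abs_le] at hu
  constructor <;> nlinarith

lemma wigglyMap_window {n : ℕ} {u : ℝ} (hu : |u| ≤ 1) :
    wigglyMap r t (center n + radius n * u) = (slope ^ (r * expo n))⁻¹ *
      (center (n + 1) + radius (n + 1) * Real.sin (freq n * u + t n)) := by
  have h := window_mem (n := n) hu
  have h3 := radius_pos n
  rw [wigglyMap_eq_of_mem (by linarith) h.2.le, windowSum_eq (n := n)]
  · simp [h3.ne']
  · rw [add_sub_cancel_left, abs_mul, abs_of_pos h3]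
    nlinarith

/-- The cutoff equals 1 up to |u| = 3/2, so the sine formula holds on a neighbourhood even at |u| =
1. The factor 1/2 is the ratio of consecutive radii. -/
lemma deriv_wigglyMap_window {n : ℕ} {u : ℝ} (hu : |u| ≤ 1) :
    deriv (wigglyMap r t) (center n + radius n * u) = (slope ^ (r * expo n))⁻¹ *
      (freq n * Real.cos (freq n * u + t n) / 2) := by
  have h := window_mem (n := n) hu
  have h3 := radius_pos n
  rw [deriv_wigglyMap_of_mem (by linarith) h.2]
  have he : windowSum r t =ᶠ[𝓝 (center n + radius n * u)] fun x => (slope ^ (r * expo n))⁻¹ *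
      (center (n + 1) + radius (n + 1) *
        Real.sin (freq n * ((radius n)⁻¹ * (x - center n)) + t n)) := by
    have hc : Continuous fun x : ℝ => |x - center n| := by fun_prop
    have : |center n + radius n * u - center n| < 3 / 2 * radius n := by
      rw [add_sub_cancel_left, abs_mul, abs_of_pos h3]
      nlinarith
    filter_upwards [hc.continuousAt.eventually_lt continuousAt_const this] with x hx
    exact windowSum_eq hx.le
  rw [he.deriv_eq]
  have h4 : HasDerivAt (fun x => freq n * ((radius n)⁻¹ * (x - center n)) + t n)
      (freq n * ((radius n)⁻¹ * 1)) (center n + radius n * u) :=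
    ((((hasDerivAt_id _).sub_const _).const_mul _).const_mul _).add_const _
  have h5 := (((h4.sin).const_mul (radius (n + 1))).const_add (center (n + 1))).const_mul
    (slope ^ (r * expo n))⁻¹
  rw [h5.deriv, radius_succ, add_sub_cancel_left, inv_mul_cancel_left₀ h3.ne']
  field_simp

end Construction

/-! ### Choice of the phases and a set of positive measure avoiding critical points. -/

section Phases

/-- The phase difference stays at distance at least π/K from 0 and from π. Jordan's inequality sin x
≥ 2x/π applies on the first half of [0, π], and by reflection on the second. -/
lemma two_div_le_abs_sin {K i j : ℕ} (hij : i < j) (hj : j < K) :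
    2 / (K : ℝ) ≤ |Real.sin (Real.pi * j / K - Real.pi * i / K)| := by
  have hK : (0 : ℝ) < K := by exact_mod_cast (Nat.zero_le j).trans_lt hj
  obtain ⟨d, rfl⟩ := Nat.exists_eq_add_of_lt hij
  have hd : ((d : ℝ) + 1) + 1 ≤ K := by exact_mod_cast (by omega : d + 1 + 1 ≤ K)
  have hd0 : (0 : ℝ) ≤ d := Nat.cast_nonneg d
  have harg : Real.pi * (i + d + 1 : ℕ) / K - Real.pi * i / K = Real.pi * ((d + 1) / K) := by
    push_cast; field_simp; ring
  have h1 : 1 / (K : ℝ) ≤ (d + 1) / K := by gcongr; linarith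
  have h2 : ((d : ℝ) + 1) / K ≤ 1 - 1 / K := by
    rw [le_sub_iff_add_le, ← add_div, div_le_one hK]; exact hd
  set y : ℝ := ((d : ℝ) + 1) / K
  have hpi := Real.pi_pos
  have hK' : 0 < 1 / (K : ℝ) := by positivity
  rw [harg]
  refine le_trans ?_ (le_abs_self _)
  rw [show (2 : ℝ) / K = 2 * (1 / K) by ring]
  rcases le_total y (1 / 2) with hy | hy
  · have := Real.mul_le_sin (x := Real.pi * y) (by positivity) (by nlinarith)
    have e : 2 / Real.pi * (Real.pi * y) = 2 * y := by field_simp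
    linarith
  · have := Real.mul_le_sin (x := Real.pi * (1 - y)) (mul_nonneg hpi.le (by linarith))
      (by nlinarith)
    have e : 2 / Real.pi * (Real.pi * (1 - y)) = 2 * (1 - y) := by field_simp
    rw [e, show Real.pi * (1 - y) = Real.pi - Real.pi * y by ring, Real.sin_pi_sub] at this
    linarith

lemma abs_sin_sub_le (a b : ℝ) : |Real.sin (a - b)| ≤ |Real.cos a| + |Real.cos b| := by
  rw [Real.sin_sub]
  refine (abs_sub _ _).trans ?_
  rw [abs_mul, abs_mul]
  have h1 := Real.abs_sin_le_one a
  have h2 := Real.abs_sin_le_one b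
  have h3 := abs_nonneg (Real.cos a)
  have h4 := abs_nonneg (Real.cos b)
  nlinarith

/-- Among `K` equidistributed phases, one keeps `|cos|` above `1/K` outside a set of proportion at
most `1/K`. -/
lemma exists_phase (μ : Measure ℝ) {g : ℝ → ℝ} (hg : Measurable g) {K : ℕ} (hK : 0 < K) :
    ∃ t : ℝ, μ {x | |Real.cos (g x + t)| < 1 / K} ≤ μ Set.univ * (K : ENNReal)⁻¹ := by
  set bad : ℕ → Set ℝ := fun j => {x | |Real.cos (g x + Real.pi * j / K)| < 1 / K} with hbad
  have hmeas : ∀ j, MeasurableSet (bad j) := fun j =>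
    measurableSet_lt (by fun_prop) measurable_const
  -- Two cosines both below 1/K would make the sine of the phase difference smaller than 2/K.
  have hne : ∀ {i j : ℕ}, i < j → j < K → Disjoint (bad i) (bad j) := by
    intro i j hij hj
    rw [Set.disjoint_left]
    intro x hi hj'
    have h1 := abs_sin_sub_le (g x + Real.pi * j / K) (g x + Real.pi * i / K)
    rw [add_sub_add_left_eq_sub] at h1
    have h2 := two_div_le_abs_sin hij hj
    have hi : |Real.cos (g x + Real.pi * i / K)| < 1 / K := hi
    have hj' : |Real.cos (g x + Real.pi * j / K)| < 1 / K := hj'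
    rw [show (2 : ℝ) / K = 1 / K + 1 / K by ring] at h2
    linarith
  have hdisj : (↑(Finset.range K) : Set ℕ).PairwiseDisjoint bad := by
    intro i hi j hj hij
    have hi := Finset.mem_range.1 hi
    have hj := Finset.mem_range.1 hj
    rcases lt_or_gt_of_ne hij with h | h
    · exact hne h hj
    · exact (hne h hi).symm
  have hsum : ∑ j ∈ Finset.range K, μ (bad j) ≤ μ Set.univ := by
    rw [← measure_biUnion_finset hdisj fun j _ => hmeas j]
    exact measure_mono (Set.subset_univ _)
  -- Pigeonhole: if every phase were worse than average, the disjoint bad sets would outweigh the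
  -- whole space.
  by_contra! hcon
  have hK0 : (K : ENNReal) ≠ 0 := by exact_mod_cast hK.ne'
  have hlt : ∑ _j ∈ Finset.range K, μ Set.univ * (K : ENNReal)⁻¹ <
      ∑ j ∈ Finset.range K, μ (bad j) :=
    ENNReal.sum_lt_sum_of_nonempty (Finset.nonempty_range_iff.2 hK.ne') fun j _ => hcon _
  rw [Finset.sum_const, Finset.card_range, nsmul_eq_mul, mul_comm, mul_assoc,
    ENNReal.inv_mul_cancel hK0 (ENNReal.natCast_ne_top K), mul_one] at hlt
  exact absurd hsum hlt.not_ge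

/-- The normalised coordinate, in the `n`-th window, of the `n`-th return of `x`. -/
noncomputable def coord (t : ℕ → ℝ) : ℕ → ℝ → ℝ
  | 0, x => (radius 0)⁻¹ * (x - center 0)
  | n + 1, x => Real.sin (freq n * coord t n x + t n)

lemma measurable_coord (t : ℕ → ℝ) (n : ℕ) : Measurable (coord t n) := by
  induction n with
  | zero => exact (by fun_prop : Measurable fun x : ℝ => (radius 0)⁻¹ * (x - center 0))
  | succ n ih =>
    exact (by fun_prop : Measurable fun x : ℝ => Real.sin (freq n * coord t n x + t n))

lemma exists_phases (μ : Measure ℝ) :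
    ∃ t : ℕ → ℝ, ∀ n, μ {x | |Real.cos (freq n * coord t n x + t n)| < 1 / (2 ^ (n + 2) : ℕ)} ≤
      μ Set.univ * ((2 ^ (n + 2) : ℕ) : ENNReal)⁻¹ := by
  have h : ∀ (n : ℕ) (g : {g : ℝ → ℝ // Measurable g}), ∃ t : ℝ,
      μ {x | |Real.cos (freq n * g.1 x + t)| < 1 / (2 ^ (n + 2) : ℕ)} ≤
        μ Set.univ * ((2 ^ (n + 2) : ℕ) : ENNReal)⁻¹ := fun n g =>
    exists_phase μ (g.2.const_mul (freq n)) (by positivity)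
  choose f hf using h
  -- The n-th coordinate involves only the earlier phases, so coordinates and phases are built
  -- together. Measurability is carried along because the choice of the next phase needs it.
  let U : ℕ → {g : ℝ → ℝ // Measurable g} := fun n => Nat.rec
    ⟨fun x => (radius 0)⁻¹ * (x - center 0), by fun_prop⟩
    (fun n g => ⟨fun x => Real.sin (freq n * g.1 x + f n g), by
      have := g.2
      fun_prop⟩) n
  have hU : ∀ n, (U n).1 = coord (fun n => f n (U n)) n := by
    intro n
    induction n with
    | zero => rfl
    | succ n ih =>
      funext x
      change Real.sin (freq n * (U n).1 x + f n (U n)) = _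
      rw [ih]
      rfl
  refine ⟨fun n => f n (U n), fun n => ?_⟩
  have := hf n (U n)
  rwa [hU n] at this

/-- The points of the zeroth window whose returns all stay away from the critical points. -/
def goodSet (t : ℕ → ℝ) : Set ℝ :=
  {x | |coord t 0 x| ≤ 1 ∧ ∀ n, 1 / 2 ^ (n + 2) ≤ |Real.cos (freq n * coord t n x + t n)|}

lemma measurableSet_goodSet (t : ℕ → ℝ) : MeasurableSet (goodSet t) := by
  have hm := measurable_coord t
  have he : goodSet t = {x | |coord t 0 x| ≤ 1} ∩
      ⋂ n, {x | 1 / 2 ^ (n + 2) ≤ |Real.cos (freq n * coord t n x + t n)|} := by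
    ext x
    simp [goodSet]
  rw [he]
  refine (measurableSet_le (hm 0).norm measurable_const).inter
    (MeasurableSet.iInter fun n => measurableSet_le measurable_const ?_)
  have := hm n
  fun_prop

lemma exists_goodSet_pos : ∃ t : ℕ → ℝ, 0 < volume (goodSet t) := by
  set J : Set ℝ := Set.Icc (center 0 - radius 0) (center 0 + radius 0)
  have hJ : volume J ≠ ⊤ := by simp [J]
  have hJ0 : volume J ≠ 0 := by
    have := radius_pos 0
    simp only [J, Real.volume_Icc, ne_eq, ENNReal.ofReal_eq_zero, not_le]
    linarith
  obtain ⟨t, ht⟩ := exists_phases (volume.restrict J)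
  refine ⟨t, pos_iff_ne_zero.2 fun h0 => ?_⟩
  set bad : ℕ → Set ℝ := fun n =>
    {x | |Real.cos (freq n * coord t n x + t n)| < 1 / (2 ^ (n + 2) : ℕ)}
  have hsub : J ⊆ goodSet t ∪ ⋃ n, bad n ∩ J := by
    intro x hx
    by_cases h : ∀ n, 1 / 2 ^ (n + 2) ≤ |Real.cos (freq n * coord t n x + t n)|
    · left
      refine ⟨?_, h⟩
      have hr := radius_pos 0
      rw [coord, abs_mul, abs_of_pos (inv_pos.2 hr), inv_mul_le_one₀ hr, abs_le]
      exact ⟨by linarith [hx.1], by linarith [hx.2]⟩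
    · right
      push Not at h
      obtain ⟨n, hn⟩ := h
      refine Set.mem_iUnion.2 ⟨n, ?_, hx⟩
      simpa [bad] using hn
  have hsum : ∑' n : ℕ, ((2 ^ (n + 2) : ℕ) : ENNReal)⁻¹ = 2⁻¹ := by
    have : ∀ n : ℕ, ((2 ^ (n + 2) : ℕ) : ENNReal)⁻¹ = (2⁻¹ * 2⁻¹) * 2⁻¹ ^ n := by
      intro n
      push_cast
      rw [← ENNReal.inv_pow, pow_add, ENNReal.mul_inv (by simp) (by simp), mul_comm, pow_two,
        ENNReal.mul_inv (by simp) (by simp)]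
    rw [tsum_congr this, ENNReal.tsum_mul_left, ENNReal.tsum_geometric, ENNReal.one_sub_inv_two,
      inv_inv, mul_assoc, ENNReal.inv_mul_cancel (by simp) (by simp), mul_one]
  -- The bad proportions add up to 1/2, so a null good set would force the window to have at most
  -- half its own length.
  have hle : volume J ≤ volume J * 2⁻¹ := by
    calc volume J ≤ volume (goodSet t ∪ ⋃ n, bad n ∩ J) := measure_mono hsub
      _ ≤ volume (goodSet t) + ∑' n, volume (bad n ∩ J) :=
          (measure_union_le _ _).trans (by gcongr; exact measure_iUnion_le _)
      _ ≤ 0 + ∑' n : ℕ, volume J * ((2 ^ (n + 2) : ℕ) : ENNReal)⁻¹ := by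
          rw [h0]
          gcongr with n
          have := ht n
          rw [Measure.restrict_apply_univ] at this
          exact (Measure.le_restrict_apply _ _).trans this
      _ = volume J * 2⁻¹ := by rw [zero_add, ENNReal.tsum_mul_left, hsum]
  rw [← div_eq_mul_inv] at hle
  exact absurd hle (ENNReal.half_lt_self hJ0 hJ).not_ge

end Phases

/-! ### Itineraries, derivative growth and time averages along good orbits. -/

section Orbits

variable {r : ℕ} {t : ℕ → ℝ} {x : ℝ}

/-- The time at which an orbit starting in the zeroth window enters the `n`-th window. -/
def entryTime (r n : ℕ) : ℕ := ∑ k ∈ Finset.range n, (1 + r * expo k)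

lemma entryTime_succ (r n : ℕ) : entryTime r (n + 1) = entryTime r n + 1 + r * expo n := by
  rw [entryTime, Finset.sum_range_succ, ← entryTime, add_assoc]

lemma abs_coord_le_one (hx : |coord t 0 x| ≤ 1) (n : ℕ) : |coord t n x| ≤ 1 := by
  cases n with
  | zero => exact hx
  | succ n => exact Real.abs_sin_le_one _

/-- The point of the `n`-th window visited by `x`. -/
noncomputable def visit (t : ℕ → ℝ) (n : ℕ) (x : ℝ) : ℝ := center n + radius n * coord t n x

lemma visit_mem (hx : |coord t 0 x| ≤ 1) (n : ℕ) : 0 < visit t n x ∧ visit t n x ≤ 1 := by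
  have := window_mem (n := n) (abs_coord_le_one hx n)
  exact ⟨by unfold visit; linarith, this.2.le⟩

/-- Before the last step of an excursion the point still lies in the linear zone [0, 1/Λ]. -/
lemma slope_mul_excursion_le (hx : |coord t 0 x| ≤ 1) {m s : ℕ} (hs : s < m) (n : ℕ) :
    slope * (slope ^ s * ((slope ^ m)⁻¹ * visit t n x)) ≤ 1 := by
  have hS := slope_pos
  have h := visit_mem hx n
  have h1 : slope ^ (s + 1) ≤ slope ^ m := pow_le_pow_right₀ one_le_slope hs
  calc slope * (slope ^ s * ((slope ^ m)⁻¹ * visit t n x))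
      = slope ^ (s + 1) * ((slope ^ m)⁻¹ * visit t n x) := by ring
    _ ≤ slope ^ m * ((slope ^ m)⁻¹ * 1) := by
        have := h.1
        gcongr
        exact h.2
    _ = 1 := by field_simp

lemma excursion_nonneg (hx : |coord t 0 x| ≤ 1) (m s n : ℕ) :
    0 ≤ slope ^ s * ((slope ^ m)⁻¹ * visit t n x) := by
  have hS := slope_pos
  have h := (visit_mem hx n).1
  positivity

lemma iterate_excursion (hx : |coord t 0 x| ≤ 1) {n : ℕ}
    (hn : (wigglyMap r t)^[entryTime r n] x = visit t n x) {s : ℕ} (hs : s ≤ r * expo n) :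
    (wigglyMap r t)^[entryTime r n + 1 + s] x =
      slope ^ s * ((slope ^ (r * expo n))⁻¹ * visit t (n + 1) x) := by
  induction s with
  | zero =>
    rw [add_zero, Function.iterate_succ_apply', hn, visit, wigglyMap_window (abs_coord_le_one hx n),
      pow_zero, one_mul]
    rfl
  | succ s ih =>
    rw [← add_assoc, Function.iterate_succ_apply', ih (by omega), wigglyMap_linear
      (excursion_nonneg hx _ _ _) (slope_mul_excursion_le hx hs _)]
    ring

lemma iterate_entryTime (hx : |coord t 0 x| ≤ 1) (n : ℕ) :
    (wigglyMap r t)^[entryTime r n] x = visit t n x := by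
  induction n with
  | zero =>
    have := radius_pos 0
    simp [entryTime, visit, coord, this.ne']
  | succ n ih =>
    rw [entryTime_succ, iterate_excursion hx ih le_rfl,
      mul_inv_cancel_left₀ (pow_pos slope_pos _).ne']

lemma differentiable_iterate (hr : 1 ≤ r) (k : ℕ) : Differentiable ℝ (wigglyMap r t)^[k] :=
  (differentiable_wigglyMap hr).iterate k

lemma deriv_iterate_succ (hr : 1 ≤ r) (k : ℕ) (x : ℝ) :
    deriv (wigglyMap r t)^[k + 1] x =
      deriv (wigglyMap r t) ((wigglyMap r t)^[k] x) * deriv (wigglyMap r t)^[k] x := by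
  rw [Function.iterate_succ']
  exact deriv_comp x (differentiable_wigglyMap hr _) (differentiable_iterate hr k x)

/-- The expansion of the passage from the `n`-th to the `(n+1)`-st window. -/
noncomputable def passage (t : ℕ → ℝ) (n : ℕ) (x : ℝ) : ℝ :=
  freq n * Real.cos (freq n * coord t n x + t n) / 2

lemma deriv_iterate_excursion (hr : 1 ≤ r) (hx : |coord t 0 x| ≤ 1) (n : ℕ) {s : ℕ}
    (hs : s ≤ r * expo n) :
    deriv (wigglyMap r t)^[entryTime r n + 1 + s] x = slope ^ s * ((slope ^ (r * expo n))⁻¹ *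
      passage t n x) * deriv (wigglyMap r t)^[entryTime r n] x := by
  induction s with
  | zero =>
    rw [add_zero, deriv_iterate_succ hr, iterate_entryTime hx, visit,
      deriv_wigglyMap_window (abs_coord_le_one hx n), pow_zero, one_mul]
    rfl
  | succ s ih =>
    rw [← add_assoc, deriv_iterate_succ hr, ih (by omega),
      iterate_excursion hx (iterate_entryTime hx n) (by omega), deriv_wigglyMap_linear
        (excursion_nonneg hx _ _ _) (slope_mul_excursion_le hx hs _)]
    ring

lemma deriv_iterate_entryTime_succ (hr : 1 ≤ r) (hx : |coord t 0 x| ≤ 1) (n : ℕ) :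
    deriv (wigglyMap r t)^[entryTime r (n + 1)] x =
      passage t n x * deriv (wigglyMap r t)^[entryTime r n] x := by
  rw [entryTime_succ, deriv_iterate_excursion hr hx n le_rfl,
    mul_inv_cancel_left₀ (pow_pos slope_pos _).ne']

lemma abs_passage_le (t : ℕ → ℝ) (n : ℕ) (x : ℝ) : |passage t n x| ≤ slope ^ expo n := by
  have h1 := Real.abs_cos_le_one (freq n * coord t n x + t n)
  have h2 : 0 ≤ freq n := zero_le_one.trans (one_le_freq n)
  have h3 : freq n ≤ slope ^ expo n :=
    div_le_self (pow_pos slope_pos _).le (one_le_pow₀ (by norm_num))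
  rw [passage, abs_div, abs_mul, abs_of_nonneg h2, abs_of_pos (zero_lt_two' ℝ)]
  nlinarith

lemma le_abs_passage (hx : x ∈ goodSet t) (n : ℕ) :
    slope ^ expo n / 8 ^ (n + 1) ≤ |passage t n x| := by
  have h1 := hx.2 n
  have h2 : 0 ≤ freq n := zero_le_one.trans (one_le_freq n)
  rw [passage, abs_div, abs_mul, abs_of_nonneg h2, abs_of_pos (zero_lt_two' ℝ)]
  -- The 8^{n+1} collects 4^n from the frequency, 2^{n+2} from the cosine bound and 2 from the ratio
  -- of radii.
  calc slope ^ expo n / 8 ^ (n + 1) = freq n * (1 / 2 ^ (n + 2)) / 2 := by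
        rw [freq, show (8 : ℝ) ^ (n + 1) = 4 ^ n * 2 ^ (n + 2) * 2 by
          rw [show (8 : ℝ) = 4 * 2 by norm_num, mul_pow]; ring]
        field_simp
    _ ≤ _ := by gcongr

/-- The sum of the exponents of the first `n` windows. -/
def expoSum (n : ℕ) : ℕ := ∑ k ∈ Finset.range n, expo k

lemma expoSum_succ (n : ℕ) : expoSum (n + 1) = expoSum n + expo n := Finset.sum_range_succ _ _

lemma entryTime_eq (r n : ℕ) : entryTime r n = n + r * expoSum n := by
  simp [entryTime, expoSum, Finset.sum_add_distrib, Finset.mul_sum]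

lemma pow_three_le_expoSum (n : ℕ) : n ^ 3 ≤ expoSum n := by
  cases n with
  | zero => simp
  | succ n => rw [expoSum_succ]; exact Nat.le_add_left _ _

lemma abs_deriv_iterate_entryTime_le (hr : 1 ≤ r) (hx : |coord t 0 x| ≤ 1) (n : ℕ) :
    |deriv (wigglyMap r t)^[entryTime r n] x| ≤ slope ^ expoSum n := by
  induction n with
  | zero => simp [entryTime, expoSum]
  | succ n ih =>
    rw [deriv_iterate_entryTime_succ hr hx, abs_mul, expoSum_succ, add_comm, pow_add]
    have := abs_passage_le t n x
    have := slope_pos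
    gcongr

/-- The losses 8^1, ..., 8^n multiply to 8^{n(n+1)/2}, bounded here by 8^{n^2}. -/
lemma le_abs_deriv_iterate_entryTime (hr : 1 ≤ r) (hx : x ∈ goodSet t) (n : ℕ) :
    slope ^ expoSum n / 8 ^ n ^ 2 ≤ |deriv (wigglyMap r t)^[entryTime r n] x| := by
  induction n with
  | zero => simp [entryTime, expoSum]
  | succ n ih =>
    have hS := slope_pos
    rw [deriv_iterate_entryTime_succ hr hx.1, abs_mul]
    have h1 : (8 : ℝ) ^ (n + 1) * 8 ^ n ^ 2 ≤ 8 ^ (n + 1) ^ 2 := by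
      rw [← pow_add]
      exact pow_le_pow_right₀ (by norm_num) (by nlinarith)
    calc slope ^ expoSum (n + 1) / 8 ^ (n + 1) ^ 2
        ≤ slope ^ expoSum (n + 1) / (8 ^ (n + 1) * 8 ^ n ^ 2) := by gcongr
      _ = (slope ^ expo n / 8 ^ (n + 1)) * (slope ^ expoSum n / 8 ^ n ^ 2) := by
          rw [expoSum_succ, pow_add]; field_simp
      _ ≤ _ := by
          have := le_abs_passage hx n
          gcongr

/-- Every time lies between two consecutive entry times. -/
lemma exists_stage (r k : ℕ) : ∃ n, entryTime r n ≤ k ∧ k < entryTime r (n + 1) := by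
  induction k with
  | zero => exact ⟨0, by simp [entryTime], by simp [entryTime_succ]⟩
  | succ k ih =>
    obtain ⟨n, h1, h2⟩ := ih
    rcases Nat.lt_or_ge (k + 1) (entryTime r (n + 1)) with h | h
    · exact ⟨n, by omega, h⟩
    · exact ⟨n + 1, h, by have := entryTime_succ r (n + 1); omega⟩

/-- The bound holds at entry times. The oscillation step then multiplies the derivative by at most
Λ^{(1-r) e_n}, and the linear steps make up for it only by the next entry, so intermediate times do
not raise the limsup. -/
lemma abs_deriv_iterate_pow_le (hr : 1 ≤ r) (hx : |coord t 0 x| ≤ 1) (k : ℕ) :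
    |deriv (wigglyMap r t)^[k] x| ^ r ≤ slope ^ k := by
  have hS := slope_pos
  obtain ⟨n, h1, h2⟩ := exists_stage r k
  have hQ := abs_deriv_iterate_entryTime_le hr hx n
  rcases h1.eq_or_lt with rfl | h1
  · calc _ ≤ (slope ^ expoSum n) ^ r := by gcongr
      _ = slope ^ (r * expoSum n) := by rw [← pow_mul, mul_comm]
      _ ≤ _ := pow_le_pow_right₀ one_le_slope (by rw [entryTime_eq]; omega)
  · obtain ⟨s, rfl⟩ : ∃ s, k = entryTime r n + 1 + s := ⟨k - (entryTime r n + 1), by omega⟩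
    have hs : s ≤ r * expo n := by rw [entryTime_succ] at h2; omega
    rw [deriv_iterate_excursion hr hx n hs, abs_mul, abs_mul, abs_mul,
      abs_of_pos (pow_pos hS _), abs_of_pos (inv_pos.2 (pow_pos hS _))]
    have hp := abs_passage_le t n x
    -- After cancellation this is implied by (r-1)s ≤ (r-1) r e_n, true since s ≤ r e_n.
    have key : r * s + r * expo n + r * expoSum n ≤
        entryTime r n + 1 + s + r * expo n * r := by
      rw [entryTime_eq]
      obtain ⟨p, rfl⟩ : ∃ p, r = p + 1 := ⟨r - 1, by omega⟩
      nlinarith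
    calc _ ≤ (slope ^ s * ((slope ^ (r * expo n))⁻¹ * slope ^ expo n) * slope ^ expoSum n) ^ r := by
          gcongr
      _ = slope ^ (r * s + r * expo n + r * expoSum n) / slope ^ (r * expo n * r) := by
          simp only [mul_pow, inv_pow, ← pow_mul, pow_add]
          rw [mul_comm s, mul_comm (expo n) r, mul_comm (expoSum n)]
          ring
      _ ≤ slope ^ (entryTime r n + 1 + s) := by
          rw [div_le_iff₀ (by positivity), ← pow_add]
          exact pow_le_pow_right₀ one_le_slope key

lemma sum_range_slope_pow_le (m : ℕ) : ∑ s ∈ Finset.range m, slope ^ s ≤ slope ^ m := by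
  induction m with
  | zero => simp
  | succ m ih =>
    rw [Finset.sum_range_succ, pow_succ]
    nlinarith [sixteen_le_slope, pow_pos slope_pos m]

/-- Each stage contributes at most 2: one visit to a window, and an excursion whose positions form a
geometric progression with sum at most 1. -/
lemma sum_iterate_entryTime_le (hx : |coord t 0 x| ≤ 1) (n : ℕ) :
    ∑ k ∈ Finset.range (entryTime r n), (wigglyMap r t)^[k] x ≤ 2 * n := by
  induction n with
  | zero => simp [entryTime]
  | succ n ih =>
    have hS := slope_pos
    have hv := visit_mem hx (n + 1)
    rw [entryTime_succ, Finset.sum_range_add, Finset.sum_range_succ, iterate_entryTime hx]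
    have h1 : ∑ s ∈ Finset.range (r * expo n), (wigglyMap r t)^[entryTime r n + 1 + s] x ≤ 1 := by
      calc _ = ∑ s ∈ Finset.range (r * expo n),
            slope ^ s * ((slope ^ (r * expo n))⁻¹ * visit t (n + 1) x) :=
            Finset.sum_congr rfl fun s hs =>
              iterate_excursion hx (iterate_entryTime hx n) (Finset.mem_range.1 hs).le
        _ = (∑ s ∈ Finset.range (r * expo n), slope ^ s) *
              ((slope ^ (r * expo n))⁻¹ * visit t (n + 1) x) := by rw [Finset.sum_mul]
        _ ≤ slope ^ (r * expo n) * ((slope ^ (r * expo n))⁻¹ * 1) := by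
            have := hv.1
            gcongr
            · exact sum_range_slope_pow_le _
            · exact hv.2
        _ = 1 := by field_simp
    have h2 := (visit_mem hx n).2
    push_cast
    linarith

lemma sum_iterate_le (hr : 1 ≤ r) (hx : |coord t 0 x| ≤ 1) (hx0 : x ∈ Set.Icc (0 : ℝ) (3 / 2))
    (k : ℕ) : ∑ j ∈ Finset.range (k + 1), (wigglyMap r t)^[j] x ≤ 3 * √(k + 1) := by
  obtain ⟨n, h1, h2⟩ := exists_stage r k
  have hnonneg : ∀ j, 0 ≤ (wigglyMap r t)^[j] x := fun j =>
    (Set.MapsTo.iterate (fun _ hy => wigglyMap_mem hr hy) j hx0).1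
  have h3 : ∑ j ∈ Finset.range (k + 1), (wigglyMap r t)^[j] x ≤ 2 * (n + 1 : ℕ) :=
    (Finset.sum_le_sum_of_subset_of_nonneg (Finset.range_mono h2) fun j _ _ => hnonneg j).trans
      (sum_iterate_entryTime_le hx (n + 1))
  -- Stage n begins after time at least n^3. The weaker n^2 already makes the averages of order
  -- 1/√k.
  have h4 : n ^ 2 ≤ k := by
    have h5 := pow_three_le_expoSum n
    rw [entryTime_eq] at h1
    have h6 : expoSum n ≤ r * expoSum n := Nat.le_mul_of_pos_left _ hr
    have h7 : n ^ 2 ≤ n ^ 3 := by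
      rcases n.eq_zero_or_pos with rfl | hn
      · simp
      · exact Nat.pow_le_pow_right hn (by norm_num)
    omega
  refine h3.trans ?_
  have h5 : (n : ℝ) ^ 2 ≤ k := by exact_mod_cast h4
  have h6 : (2 * ((n : ℝ) + 1)) / 3 ≤ √(k + 1) := by
    apply Real.le_sqrt_of_sq_le
    nlinarith [sq_nonneg ((n : ℝ) - 1)]
  push_cast
  linarith

end Orbits

/-! ### Entropy of a Dirac mass. -/

section Entropy

variable {X : Type*} [MeasurableSpace X] [MeasurableSingletonClass X]

lemma joinEntropy_dirac (T : X → X) (x : X) {k : ℕ} (P : X → Fin k) (n : ℕ) :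
    joinEntropy T (Measure.dirac x) P n = 0 := by
  -- Every cylinder has mass 0 or 1, and x log x vanishes at both.
  refine Finset.sum_eq_zero fun a _ => ?_
  rw [Measure.real, Measure.dirac_apply]
  by_cases h : x ∈ {x | ∀ i : Fin n, P (T^[i] x) = a i}
  · rw [Set.indicator_of_mem h]; simp
  · rw [Set.indicator_of_notMem h]; simp

lemma metricEntropy_dirac (T : X → X) (x : X) : metricEntropy T (Measure.dirac x) = 0 := by
  simp only [metricEntropy, joinEntropy_dirac, zero_div, EReal.coe_zero, limsup_const]
  refine le_antisymm (by simp) ?_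
  -- In `EReal` the lower bound needs an actual partition; the one-cell partition serves.
  exact le_iSup₂_of_le 1 (fun _ => 0) (le_iSup_of_le measurable_const le_rfl)

end Entropy

/-! ### Weak-* convergence from averages of positions. -/

section Empirical

lemma integral_empiricalMeasure {T : I → I} (x : I) (n : ℕ)
    (f : BoundedContinuousFunction I ℝ) :
    ∫ y, f y ∂(empiricalMeasure T x n : Measure I) =
      (∑ k ∈ Finset.range (n + 1), f (T^[k] x)) / (n + 1) := by
  change ∫ y, f y ∂(((n + 1 : ℕ) : ENNReal)⁻¹ • ∑ k ∈ Finset.range (n + 1),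
    Measure.dirac (T^[k] x)) = _
  rw [integral_smul_measure, integral_finsetSum_measure fun k _ => f.integrable _]
  simp only [integral_dirac, ENNReal.toReal_inv, ENNReal.toReal_natCast, smul_eq_mul]
  push_cast
  rw [inv_mul_eq_div]

/-- If the average of the positions tends to `0`, the empirical measures tend to the Dirac mass
at the origin. -/
lemma tendsto_empiricalMeasure_of_average {T : I → I} {x : I}
    (h : Tendsto (fun n : ℕ => (∑ k ∈ Finset.range (n + 1), (T^[k] x : ℝ)) / (n + 1)) atTop
      (𝓝 0)) :
    Tendsto (empiricalMeasure T x) atTop (𝓝 (diracMass origin)) := by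
  rw [ProbabilityMeasure.tendsto_iff_forall_integral_tendsto]
  intro f
  change Tendsto _ _ (𝓝 (∫ y, f y ∂(Measure.dirac origin)))
  rw [integral_dirac]
  simp only [integral_empiricalMeasure]
  rw [Metric.tendsto_atTop]
  intro ε hε
  obtain ⟨η, hη, hfη⟩ := Metric.continuousAt_iff.1 (f.continuous.continuousAt (x := origin))
    (ε / 2) (by linarith)
  set C : ℝ := 2 * ‖f‖ / η
  have hC : 0 ≤ C := by positivity
  -- Continuity handles y < η. Beyond η the linear term dominates the oscillation 2‖f‖, which fixes
  -- C.
  have hbound : ∀ y : I, |f y - f origin| ≤ ε / 2 + C * y := by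
    intro y
    have hy0 : (0 : ℝ) ≤ y := y.2.1
    rcases lt_or_ge (y : ℝ) η with hy | hy
    · have h1 : dist y origin < η := by
        rw [Subtype.dist_eq, Real.dist_eq]
        simpa [origin, abs_of_nonneg hy0] using hy
      have h2 := hfη h1
      rw [Real.dist_eq] at h2
      have := mul_nonneg hC hy0
      linarith
    · have h1 : |f y - f origin| ≤ 2 * ‖f‖ := by
        rw [← Real.dist_eq]
        exact f.dist_le_two_norm y origin
      have h2 : 2 * ‖f‖ ≤ C * y := by
        calc 2 * ‖f‖ = C * η := by simp only [C]; field_simp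
          _ ≤ C * y := by gcongr
      linarith
  -- C + 1 replaces C because C vanishes when f = 0.
  obtain ⟨N, hN⟩ := Metric.tendsto_atTop.1 h (ε / (2 * (C + 1))) (by positivity)
  refine ⟨N, fun n hn => ?_⟩
  have h1 := hN n hn
  have hn0 : (0 : ℝ) < n + 1 := by positivity
  rw [Real.dist_eq, sub_zero] at h1
  have h2 := (le_abs_self _).trans_lt h1
  rw [Real.dist_eq]
  set S := (∑ k ∈ Finset.range (n + 1), (T^[k] x : ℝ)) / (n + 1)
  have hS0 : 0 ≤ S := div_nonneg (Finset.sum_nonneg fun k _ => (T^[k] x).2.1) hn0.le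
  have e : (∑ k ∈ Finset.range (n + 1), f (T^[k] x)) / (n + 1) - f origin =
      (∑ k ∈ Finset.range (n + 1), (f (T^[k] x) - f origin)) / (n + 1) := by
    rw [Finset.sum_sub_distrib, Finset.sum_const, Finset.card_range, nsmul_eq_mul]
    push_cast
    field_simp
  calc _ ≤ (∑ k ∈ Finset.range (n + 1), (ε / 2 + C * (T^[k] x : ℝ))) / (n + 1) := by
        rw [e, abs_div, abs_of_pos hn0]
        gcongr
        exact (Finset.abs_sum_le_sum_abs _ _).trans (Finset.sum_le_sum fun k _ => hbound _)
    _ = ε / 2 + C * S := by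
        rw [Finset.sum_add_distrib, ← Finset.mul_sum, Finset.sum_const, Finset.card_range,
          nsmul_eq_mul]
        simp only [S]
        push_cast
        field_simp
    _ ≤ ε / 2 + (C + 1) * S := by nlinarith
    _ < ε / 2 + (C + 1) * (ε / (2 * (C + 1))) := by gcongr
    _ = ε := by field_simp; ring

end Empirical

/-! ### Transfer to the interval and computation of the Lyapunov exponent. -/

section IntervalMap

variable {r : ℕ} {t : ℕ → ℝ}

/-- The map, as a self-map of the interval. -/
noncomputable def wigglyIntervalMap (hr : 1 ≤ r) (t : ℕ → ℝ) (x : I) : I :=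
  ⟨wigglyMap r t x, wigglyMap_mem hr x.2⟩

lemma coe_iterate_wigglyIntervalMap (hr : 1 ≤ r) (k : ℕ) (x : I) :
    (((wigglyIntervalMap hr t)^[k] x : I) : ℝ) = (wigglyMap r t)^[k] x := by
  induction k with
  | zero => rfl
  | succ k ih => rw [Function.iterate_succ_apply', Function.iterate_succ_apply', ← ih]; rfl

lemma eqOn_toReal_iterate (hr : 1 ≤ r) (k : ℕ) :
    Set.EqOn (toReal (wigglyIntervalMap hr t)^[k]) (wigglyMap r t)^[k] (Set.Icc 0 (3 / 2)) := by
  intro x hx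
  rw [toReal, Set.IccExtend_of_mem _ _ hx, coe_iterate_wigglyIntervalMap]

lemma eqOn_toReal (hr : 1 ≤ r) :
    Set.EqOn (toReal (wigglyIntervalMap hr t)) (wigglyMap r t) (Set.Icc 0 (3 / 2)) :=
  eqOn_toReal_iterate hr 1

lemma derivAt_iterate (hr : 1 ≤ r) (k : ℕ) (x : I) :
    derivAt (wigglyIntervalMap hr t)^[k] x = deriv (wigglyMap r t)^[k] x := by
  rw [derivAt, derivWithin_congr (eqOn_toReal_iterate hr k) (eqOn_toReal_iterate hr k x.2)]
  exact (differentiable_iterate hr k x).derivWithin (uniqueDiffOn_Icc (by norm_num) x x.2)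

lemma derivAt_wigglyIntervalMap (hr : 1 ≤ r) (x : I) :
    derivAt (wigglyIntervalMap hr t) x = deriv (wigglyMap r t) x :=
  derivAt_iterate hr 1 x

lemma isClassC_wigglyIntervalMap (hr : 1 ≤ r) : IsClassC r (wigglyIntervalMap hr t) :=
  (contDiff_wigglyMap hr).contDiffOn.congr (eqOn_toReal hr)

lemma not_isClassC_wigglyIntervalMap (hr : 1 ≤ r) :
    ¬ IsClassC (r + 1) (wigglyIntervalMap hr t) := by
  intro h
  have h1 : ContDiffAt ℝ (r + 1 : ℕ) (toReal (wigglyIntervalMap hr t)) 1 :=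
    h.contDiffAt (Icc_mem_nhds (by norm_num) (by norm_num))
  have h2 : ContDiffAt ℝ (r + 1 : ℕ) (fun x : ℝ => max 0 (x - 1) ^ (r + 1)) 1 := by
    refine h1.congr_of_eventuallyEq ?_
    filter_upwards [Icc_mem_nhds (show (7 / 8 : ℝ) < 1 by norm_num)
      (show (1 : ℝ) < 3 / 2 by norm_num)] with x hx
    rw [eqOn_toReal hr ⟨by linarith [hx.1], hx.2⟩, wigglyMap_eq_of_ge hx.1]
  apply not_contDiffAt_max_zero_pow r
  have h3 : ContDiffAt ℝ (r + 1 : ℕ) (fun y : ℝ => y + 1) 0 := by fun_prop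
  have h4 := ContDiffAt.comp (0 : ℝ) (f := fun y : ℝ => y + 1) (by simpa using h2) h3
  simpa [Function.comp_def] using h4

lemma wigglyIntervalMap_origin (hr : 1 ≤ r) : wigglyIntervalMap hr t origin = origin := by
  apply Subtype.ext
  change wigglyMap r t 0 = 0
  rw [wigglyMap_linear le_rfl (by simp), mul_zero]

lemma derivAt_wigglyIntervalMap_origin (hr : 1 ≤ r) :
    derivAt (wigglyIntervalMap hr t) origin = slope := by
  rw [derivAt_wigglyIntervalMap]
  exact deriv_wigglyMap_linear (x := 0) le_rfl (by simp)

lemma supDeriv_wigglyIntervalMap (hr : 1 ≤ r) : supDeriv (wigglyIntervalMap hr t) = slope := by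
  have hb : ∀ x : I, |derivAt (wigglyIntervalMap hr t) x| ≤ slope := fun x => by
    rw [derivAt_wigglyIntervalMap]
    exact abs_deriv_wigglyMap_le hr x.2.2
  have : Nonempty I := ⟨origin⟩
  refine le_antisymm (ciSup_le hb) ?_
  have := le_ciSup (f := fun x : I => |derivAt (wigglyIntervalMap hr t) x|)
    ⟨slope, by rintro _ ⟨x, rfl⟩; exact hb x⟩ origin
  simp only [derivAt_wigglyIntervalMap_origin, abs_of_pos slope_pos] at this
  exact this

lemma continuous_wigglyIntervalMap (hr : 1 ≤ r) : Continuous (wigglyIntervalMap hr t) :=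
  Continuous.subtype_mk ((contDiff_wigglyMap hr).continuous.comp continuous_subtype_val) _

lemma log_slope_pos : 0 < Real.log slope := Real.log_pos (by linarith [sixteen_le_slope])

lemma tendsto_empiricalMeasure (hr : 1 ≤ r) {x : I} (hx : |coord t 0 x| ≤ 1) :
    Tendsto (empiricalMeasure (wigglyIntervalMap hr t) x) atTop (𝓝 (diracMass origin)) := by
  apply tendsto_empiricalMeasure_of_average
  simp only [coe_iterate_wigglyIntervalMap]
  have hlim : Tendsto (fun n : ℕ => 3 / √((n : ℝ) + 1)) atTop (𝓝 0) :=
    tendsto_const_nhds.div_atTop (Real.tendsto_sqrt_atTop.comp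
      (tendsto_atTop_add_const_right _ _ tendsto_natCast_atTop_atTop))
  refine squeeze_zero (fun n => ?_) (fun n => ?_) hlim
  · refine div_nonneg (Finset.sum_nonneg fun j _ => ?_) (by positivity)
    rw [← coe_iterate_wigglyIntervalMap hr]
    exact ((wigglyIntervalMap hr t)^[j] x).2.1
  · have h := sum_iterate_le hr hx x.2 n
    have hn : (0 : ℝ) < n + 1 := by positivity
    rw [div_le_div_iff₀ hn (Real.sqrt_pos.2 hn)]
    calc _ ≤ 3 * √((n : ℝ) + 1) * √((n : ℝ) + 1) := by gcongr
      _ = _ := by rw [mul_assoc, Real.mul_self_sqrt hn.le]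

/-- By the chain rule a zero derivative persists at all later times, contradicting the lower bound
at the next entry time. -/
lemma deriv_iterate_ne_zero (hr : 1 ≤ r) {x : ℝ} (hx : x ∈ goodSet t) (k : ℕ) :
    deriv (wigglyMap r t)^[k] x ≠ 0 := by
  obtain ⟨n, -, h2⟩ := exists_stage r k
  have hpos : deriv (wigglyMap r t)^[entryTime r (n + 1)] x ≠ 0 := by
    have h := le_abs_deriv_iterate_entryTime hr hx (n + 1)
    have : 0 < slope ^ expoSum (n + 1) / 8 ^ (n + 1) ^ 2 := by
      have := slope_pos
      positivity
    exact abs_pos.1 (this.trans_le h)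
  intro h0
  apply hpos
  obtain ⟨s, hs⟩ := Nat.exists_eq_add_of_le h2.le
  rw [hs]
  clear hs
  induction s with
  | zero => exact h0
  | succ s ih => rw [← add_assoc, deriv_iterate_succ hr, ih, mul_zero]

lemma log_abs_deriv_iterate_le (hr : 1 ≤ r) {x : ℝ} (hx : x ∈ goodSet t) (k : ℕ) :
    Real.log |deriv (wigglyMap r t)^[k] x| ≤ k * (Real.log slope / r) := by
  have h := Real.log_le_log (pow_pos (abs_pos.2 (deriv_iterate_ne_zero hr hx k)) r)
    (abs_deriv_iterate_pow_le hr hx.1 k)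
  rw [Real.log_pow, Real.log_pow] at h
  have hr0 : (0 : ℝ) < r := by exact_mod_cast hr
  rw [← mul_div_assoc, le_div_iff₀ hr0]
  linarith

/-- The time is n + r Q with Q = `expoSum n`. The extra n steps and the loss 8^{n^2} cost at most
(log Λ + log 8) n^2 in total, while the time is at least n^3. -/
lemma le_log_abs_deriv_iterate_entryTime (hr : 1 ≤ r) {x : ℝ} (hx : x ∈ goodSet t) {n : ℕ}
    (hn : 1 ≤ n) : Real.log slope / r - (Real.log slope + Real.log 8) / n ≤
      Real.log |deriv (wigglyMap r t)^[entryTime r n] x| / entryTime r n := by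
  have hS := slope_pos
  have hl := log_slope_pos
  have h8 : 0 < Real.log 8 := Real.log_pos (by norm_num)
  have h := Real.log_le_log (by positivity) (le_abs_deriv_iterate_entryTime hr hx n)
  rw [Real.log_div (by positivity) (by positivity), Real.log_pow, Real.log_pow] at h
  have hr1 : (1 : ℝ) ≤ r := by exact_mod_cast hr
  have hn1 : (1 : ℝ) ≤ n := by exact_mod_cast hn
  have hT : (entryTime r n : ℝ) = n + r * expoSum n := by exact_mod_cast entryTime_eq r n
  have hQ : (n : ℝ) ^ 3 ≤ expoSum n := by exact_mod_cast pow_three_le_expoSum n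
  have hQ0 : (0 : ℝ) ≤ expoSum n := Nat.cast_nonneg _
  have hTpos : (0 : ℝ) < entryTime r n := by rw [hT]; positivity
  have hTn : (n : ℝ) ^ 3 ≤ entryTime r n := by
    rw [hT]; nlinarith
  rw [le_div_iff₀ hTpos, sub_mul]
  push_cast at h
  have e1 : Real.log slope / r * entryTime r n =
      Real.log slope / r * n + Real.log slope * expoSum n := by
    rw [hT]; field_simp
  have e2 : Real.log slope / r * n ≤ Real.log slope * n ^ 2 := by
    have : Real.log slope / r ≤ Real.log slope := div_le_self hl.le hr1
    calc _ ≤ Real.log slope * n := by gcongr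
      _ ≤ _ := by gcongr; nlinarith
  have e3 : (Real.log slope + Real.log 8) * n ^ 2 ≤
      (Real.log slope + Real.log 8) / n * entryTime r n := by
    calc _ = (Real.log slope + Real.log 8) / n * n ^ 3 := by field_simp
      _ ≤ _ := by gcongr
  linarith

lemma le_entryTime (r n : ℕ) : n ≤ entryTime r n := by
  rw [entryTime_eq]; exact Nat.le_add_right _ _

lemma lyapunov_wigglyIntervalMap (hr : 1 ≤ r) {x : I} (hx : (x : ℝ) ∈ goodSet t) :
    lyapunov (wigglyIntervalMap hr t) x = ((Real.log slope / r : ℝ) : EReal) := by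
  have hterm : ∀ n : ℕ, ENNReal.log ‖derivAt (wigglyIntervalMap hr t)^[n] x‖ₑ / (n : EReal) =
      ((Real.log |deriv (wigglyMap r t)^[n] x| / n : ℝ) : EReal) := by
    intro n
    rw [derivAt_iterate, ← ofReal_norm, ENNReal.log_ofReal_of_pos
      (norm_pos_iff.2 (deriv_iterate_ne_zero hr hx n)), Real.norm_eq_abs, EReal.coe_div]
    rfl
  simp only [lyapunov, hterm]
  apply le_antisymm
  · refine limsup_le_of_le (h := ?_)
    filter_upwards [eventually_ge_atTop 1] with n hn
    have hn0 : (0 : ℝ) < n := by exact_mod_cast hn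
    rw [EReal.coe_le_coe_iff, div_le_iff₀ hn0, mul_comm]
    exact log_abs_deriv_iterate_le hr hx n
  -- A limsup only needs the lower bound along a subsequence, here the entry times.
  · refine le_of_forall_lt fun c hc => ?_
    obtain ⟨d, hcd, hd⟩ := EReal.lt_iff_exists_real_btwn.1 hc
    refine hcd.trans_le (le_limsup_of_frequently_le ?_)
    have hd := EReal.coe_lt_coe_iff.1 hd
    have hlim : Tendsto (fun n : ℕ => Real.log slope / r - (Real.log slope + Real.log 8) / n)
        atTop (𝓝 (Real.log slope / r)) := by
      have h0 : Tendsto (fun n : ℕ => (Real.log slope + Real.log 8) / (n : ℝ)) atTop (𝓝 0) :=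
        tendsto_const_nhds.div_atTop tendsto_natCast_atTop_atTop
      simpa using h0.const_sub (Real.log slope / r)
    rw [frequently_atTop]
    intro N
    obtain ⟨n, hn, hN⟩ := ((hlim.eventually (lt_mem_nhds hd)).and
      (eventually_ge_atTop (N + 1))).exists
    refine ⟨entryTime r n, (by omega : N ≤ n).trans (le_entryTime r n), ?_⟩
    rw [EReal.coe_le_coe_iff]
    exact hn.le.trans (le_log_abs_deriv_iterate_entryTime hr hx (by omega))

lemma goodSet_subset (t : ℕ → ℝ) : goodSet t ⊆ Set.Icc (0 : ℝ) (3 / 2) := by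
  intro x hx
  have h := visit_mem hx.1 0
  have h1 := radius_pos 0
  rw [visit, coord, mul_inv_cancel_left₀ h1.ne', add_sub_cancel] at h
  exact ⟨h.1.le, h.2.trans (by norm_num)⟩

lemma leb_preimage_goodSet (t : ℕ → ℝ) :
    leb (Subtype.val ⁻¹' goodSet t) = volume (goodSet t) := by
  rw [leb, (MeasurableEmbedding.subtype_coe measurableSet_Icc).comap_apply,
    Subtype.image_preimage_coe, Set.inter_eq_right.2 (goodSet_subset t)]

end IntervalMap

/-! ### Failure of the two entropy inequalities. -/

section Failure

variable {h : I → I} {E : Set I} {c : ℝ}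

/-- The weak-* topology is Hausdorff, so a convergent sequence has no accumulation point but its
limit. -/
lemma eq_of_mem_accumulationMeasures {x : I} {μ ν : ProbabilityMeasure I}
    (hx : Tendsto (empiricalMeasure h x) atTop (𝓝 ν)) (hμ : μ ∈ accumulationMeasures h x) :
    μ = ν := by
  by_contra hne
  obtain ⟨U, V, hU, hV, hμU, hνV, hUV⟩ := t2_separation hne
  have h1 := (mapClusterPt_iff_frequently.1 hμ) U (hU.mem_nhds hμU)
  obtain ⟨n, hn1, hn2⟩ := (h1.and_eventually (hx.eventually (hV.mem_nhds hνV))).exists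
  exact Set.disjoint_left.1 hUV hn1 hn2

lemma not_ae_exists_accumulationMeasure (hE : 0 < leb E) (hc : 0 < c)
    (hconv : ∀ x ∈ E, Tendsto (empiricalMeasure h x) atTop (𝓝 (diracMass origin)))
    (hlyap : ∀ x ∈ E, lyapunov h x = (c : EReal)) :
    ¬ ∀ᵐ x ∂leb, ∃ μ ∈ accumulationMeasures h x,
      sumPosLyapunov h x ≤ metricEntropy h (μ : Measure I) := by
  intro hae
  refine hE.ne' (measure_mono_null (fun x hx => ?_) (ae_iff.1 hae))
  rintro ⟨μ, hμ, hle⟩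
  rw [eq_of_mem_accumulationMeasures (hconv x hx) hμ] at hle
  have h0 : metricEntropy h (diracMass origin : Measure I) = 0 := metricEntropy_dirac h origin
  rw [h0, sumPosLyapunov, hlyap x hx] at hle
  exact absurd ((le_max_right _ _).trans hle) (not_le.2 (EReal.coe_pos.2 hc))

lemma not_essSup_le_metricEntropy (hE : 0 < leb E) (hc : 0 < c)
    (hEm : MeasurableSet E)
    (hconv : ∀ x ∈ E, Tendsto (empiricalMeasure h x) atTop (𝓝 (diracMass origin)))
    (hlyap : ∀ x ∈ E, lyapunov h x = (c : EReal)) :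
    ¬ essSup (sumPosLyapunov h) (leb.restrict (basin h (diracMass origin))) ≤
      metricEntropy h (diracMass origin : Measure I) := by
  intro hle
  have h0 : metricEntropy h (diracMass origin : Measure I) = 0 := metricEntropy_dirac h origin
  rw [h0] at hle
  have hae : ∀ᵐ x ∂leb.restrict (basin h (diracMass origin)), sumPosLyapunov h x ≤ 0 :=
    (ae_le_essSup (f := sumPosLyapunov h)).mono fun x hx => hx.trans hle
  -- Passing to the measurable subset E of the basin avoids any need for measurability of the basin.
  have hae' : ∀ᵐ x ∂leb.restrict E, sumPosLyapunov h x ≤ 0 :=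
    ae_mono (Measure.restrict_mono hconv le_rfl) hae
  rw [ae_restrict_iff' hEm] at hae'
  refine hE.ne' (measure_mono_null (fun x hx => ?_) (ae_iff.1 hae'))
  intro hx'
  have := hx' hx
  rw [sumPosLyapunov, hlyap x hx] at this
  exact absurd ((le_max_right _ _).trans this) (not_le.2 (EReal.coe_pos.2 hc))

end Failure

end IntervalDynamics

theorem mainTheorem6 (r : ℕ) (hr : 1 ≤ r) :
    ∃ h : IntervalDynamics.I → IntervalDynamics.I,
      IntervalDynamics.IsClassC r h ∧ ¬ IntervalDynamics.IsClassC (r + 1) h ∧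
      -- `0` is a fixed point and a source
      h IntervalDynamics.origin = IntervalDynamics.origin ∧
      1 < |IntervalDynamics.derivAt h IntervalDynamics.origin| ∧
      0 < Real.log (IntervalDynamics.supDeriv h) / r ∧
      (∃ E : Set IntervalDynamics.I, MeasurableSet E ∧ 0 < IntervalDynamics.leb E ∧
        ∀ x ∈ E,
          Tendsto (IntervalDynamics.empiricalMeasure h x) atTop
            (𝓝 (IntervalDynamics.diracMass IntervalDynamics.origin)) ∧
          IntervalDynamics.lyapunov h x =
            ((Real.log (IntervalDynamics.supDeriv h) / r : ℝ) : EReal)) ∧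
      -- the Dirac mass at `0` is a physical measure of zero entropy
      IntervalDynamics.IsPhysical IntervalDynamics.leb h
        (IntervalDynamics.diracMass IntervalDynamics.origin) ∧
      IntervalDynamics.metricEntropy h
        (IntervalDynamics.diracMass IntervalDynamics.origin : Measure IntervalDynamics.I) = 0 ∧
      -- the conclusion of the Main Theorem fails for `h`
      (¬ ∀ᵐ x ∂IntervalDynamics.leb, ∃ μ ∈ IntervalDynamics.accumulationMeasures h x,
        IntervalDynamics.sumPosLyapunov h x ≤
          IntervalDynamics.metricEntropy h (μ : Measure IntervalDynamics.I)) ∧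
      -- the conclusion of the corollary on physical measures fails for `h`
      (¬ ∀ μ : ProbabilityMeasure IntervalDynamics.I,
        IntervalDynamics.IsPhysical IntervalDynamics.leb h μ →
          essSup (IntervalDynamics.sumPosLyapunov h)
              (IntervalDynamics.leb.restrict (IntervalDynamics.basin h μ)) ≤
            IntervalDynamics.metricEntropy h (μ : Measure IntervalDynamics.I)) := by

  obtain ⟨t, ht⟩ := IntervalDynamics.exists_goodSet_pos
  have hEm : MeasurableSet (Subtype.val ⁻¹' IntervalDynamics.goodSet t : Set IntervalDynamics.I) :=
    measurable_subtype_coe (IntervalDynamics.measurableSet_goodSet t)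
  have hE : 0 < IntervalDynamics.leb (Subtype.val ⁻¹' IntervalDynamics.goodSet t) := by
    rwa [IntervalDynamics.leb_preimage_goodSet]
  have hc : 0 < Real.log IntervalDynamics.slope / r :=
    div_pos IntervalDynamics.log_slope_pos (by exact_mod_cast hr)
  have hconv : ∀ x ∈ (Subtype.val ⁻¹' IntervalDynamics.goodSet t : Set IntervalDynamics.I),
      Tendsto (IntervalDynamics.empiricalMeasure (IntervalDynamics.wigglyIntervalMap hr t) x) atTop
        (𝓝 (IntervalDynamics.diracMass IntervalDynamics.origin)) := fun x hx =>
    IntervalDynamics.tendsto_empiricalMeasure hr hx.1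
  have hlyap : ∀ x ∈ (Subtype.val ⁻¹' IntervalDynamics.goodSet t : Set IntervalDynamics.I),
      IntervalDynamics.lyapunov (IntervalDynamics.wigglyIntervalMap hr t) x =
        ((Real.log IntervalDynamics.slope / r : ℝ) : EReal) := fun x hx =>
    IntervalDynamics.lyapunov_wigglyIntervalMap hr hx
  have hphys : IntervalDynamics.IsPhysical IntervalDynamics.leb
      (IntervalDynamics.wigglyIntervalMap hr t)
      (IntervalDynamics.diracMass IntervalDynamics.origin) := by
    refine ⟨⟨(IntervalDynamics.continuous_wigglyIntervalMap hr).measurable, ?_⟩,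
      hE.trans_le (measure_mono hconv)⟩
    change Measure.map _ (Measure.dirac IntervalDynamics.origin) =
      Measure.dirac IntervalDynamics.origin
    rw [Measure.map_dirac' (IntervalDynamics.continuous_wigglyIntervalMap hr).measurable,
      IntervalDynamics.wigglyIntervalMap_origin]
  refine ⟨IntervalDynamics.wigglyIntervalMap hr t,
    IntervalDynamics.isClassC_wigglyIntervalMap hr,
    IntervalDynamics.not_isClassC_wigglyIntervalMap hr,
    IntervalDynamics.wigglyIntervalMap_origin hr, ?_, ?_,
    ⟨Subtype.val ⁻¹' IntervalDynamics.goodSet t, hEm, hE, fun x hx => ⟨hconv x hx, ?_⟩⟩,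
    hphys, IntervalDynamics.metricEntropy_dirac _ _,
    IntervalDynamics.not_ae_exists_accumulationMeasure hE hc hconv hlyap,
    fun hall => IntervalDynamics.not_essSup_le_metricEntropy hE hc hEm hconv hlyap
      (hall _ hphys)⟩
  · rw [IntervalDynamics.derivAt_wigglyIntervalMap_origin, abs_of_pos IntervalDynamics.slope_pos]
    linarith [IntervalDynamics.sixteen_le_slope]
  · rwa [IntervalDynamics.supDeriv_wigglyIntervalMap]
  · rw [IntervalDynamics.supDeriv_wigglyIntervalMap]
    exact hlyap x hx
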